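/- Let $n\in\mathbb N$, let $\mathcal L(\mathbb R^n)$ be the $n\times n$ real matrices with the operator norm, and let $\omega>0$. For $a<b$, $\int_a^b \mathrm d[A(s)]g(s)$ denotes the Kurzweil–Stieltjes integral: the vector $X$ such that for every $\varepsilon>0$ there is a gauge $\delta:[a,b]\to(0,\infty)$ with $\bigl\|\sum_j [A(\alpha_j)-A(\alpha_{j-1})]g(\tau_j)-X\bigr\|<\varepsilon$ for every $\delta$-fine tagged partition $a=\alpha_0<\dots<\alpha_\nu=b$, $\tau_j\in[\alpha_{j-1},\alpha_j]\subset(\tau_j-\delta(\tau_j),\tau_j+\delta(\tau_j))$; also $\int_b^a=-\int_a^b$ and $\int_a^a=0$. Let $A:\mathbb R\to\mathcal L(\mathbb R^n)$ be of locally bounded variation, let $C\in\mathcal L(\mathbb R^n)$ be a constant matrix with $A(t+\omega)-A(t)=C$ for all $t\in\mathbb R$, and let $f:\mathbb R\to\mathbb R^n$ be $\omega$-periodic and regulated (that is, it has finite one-sided limits at every point). Assume (H) the matrices $I-[A(t)-A(t^-)]$ and $I+[A(t^+)-A(t)]$ are invertible for all $t\in\mathbb R$. A solution of $\frac{dx}{d\tau}=D[A(t)x+f(t)]$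 is a function $x:\mathbb R\to\mathbb R^n$ such that, for all $s,t\in\mathbb R$, the integral below exists and $x(t)=x(s)+\int_s^t\mathrm d[A(r)]x(r)+f(t)-f(s)$. The transition matrix of the homogeneous equation $\frac{dx}{d\tau}=D[A(t)x]$ is the function $U:\mathbb R\times\mathbb R\to\mathcal L(\mathbb R^n)$, existing and unique under these assumptions, with $U(t,s)=I+\int_s^t\mathrm d[A(r)]U(r,s)$ for all $t,s\in\mathbb R$ (columnwise). Assume that the homogeneous equation has an exponential dichotomy on $\mathbb R$: with $\mathcal U(t)=U(t,0)$ there are $K,\alpha>0$ and a projection $P=P^2\in\mathcal L(\mathbb R^n)$ such that $$\|\mathcal U(t)P\,\mathcal U^{-1}(s)\|\le Ke^{-\alpha(t-s)}\ (t\ge s),\qquad \|\mathcal U(t)(I-P)\,\mathcal U^{-1}(s)\|\le Ke^{-\alpha(s-t)}\ (s\ge t).$$ Then the inhomogeneous equation $\frac{dx}{d\tau}=D[A(t)x+f(t)]$ has exactly one $\omega$-periodic solution, and this solution is regulated. Moreover $I-U(\omega,0)$ is invertible, the integral $\int_0^\omega\mathrm d[U(\omega,s)](f(s)-f(0))$ exists,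 and the $\omega$-periodic solution is the unique solution of the equation with initial value $$x(0)=-[I-U(\omega,0)]^{-1}\int_0^\omega \mathrm d[U(\omega,s)]\,(f(s)-f(0)).$$ -/

import Mathlib

open Filter Topology

noncomputable section

namespace GLDE

variable {E : Type*} [NormedAddCommGroup E] [NormedSpace ℝ E]

/-- A function on `ℝ` is regulated if it has one-sided limits (with values in `X`) at every
point; equivalently, its restriction to every compact interval is regulated. -/
def IsRegulated {X : Type*} [TopologicalSpace X] (φ : ℝ → X) : Prop :=
  ∀ t : ℝ, (∃ y, Tendsto φ (𝓝[<] t) (𝓝 y)) ∧ (∃ y, Tendsto φ (𝓝[>] t) (𝓝 y))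

/-- The points `α 0 < ⋯ < α ν` with the tags `τ 0, …, τ (ν - 1)` form a tagged partition of
`[a, b]`. -/
def IsTaggedPartition (a b : ℝ) (ν : ℕ) (α τ : ℕ → ℝ) : Prop :=
  α 0 = a ∧ α ν = b ∧ ∀ j < ν, α j < α (j + 1) ∧ τ j ∈ Set.Icc (α j) (α (j + 1))

/-- `δ`-fineness of a tagged partition. -/
def IsFine (δ : ℝ → ℝ) (ν : ℕ) (α τ : ℕ → ℝ) : Prop :=
  ∀ j < ν, Set.Icc (α j) (α (j + 1)) ⊆ Set.Ioo (τ j - δ (τ j)) (τ j + δ (τ j))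

/-- `X` is the Kurzweil–Stieltjes integral `∫_a^b d[A(s)] g(s)`, in the case `a ≤ b`. -/
def HasKSIntegralOn (A : ℝ → E →L[ℝ] E) (g : ℝ → E) (a b : ℝ) (X : E) : Prop :=
  ∀ ε > 0, ∃ δ : ℝ → ℝ, (∀ t ∈ Set.Icc a b, 0 < δ t) ∧
    ∀ (ν : ℕ) (α τ : ℕ → ℝ), IsTaggedPartition a b ν α τ → IsFine δ ν α τ →
      ‖∑ j ∈ Finset.range ν, (A (α (j + 1)) - A (α j)) (g (τ j)) - X‖ < ε

/-- `∫_a^b d[A(s)] g(s)` exists and equals `X`, for `a` and `b` in any order, with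
`∫_a^b = -∫_b^a`. If `a = b`, both clauses say that `X = 0`. -/
def HasKSIntegral (A : ℝ → E →L[ℝ] E) (g : ℝ → E) (a b : ℝ) (X : E) : Prop :=
  (a ≤ b → HasKSIntegralOn A g a b X) ∧ (b ≤ a → HasKSIntegralOn A g b a (-X))

/-- `x` is a solution on `ℝ` of `dx/dτ = D[A(t)x + f(t)]`, that is,
`x(t) = x(s) + ∫_s^t d[A(r)] x(r) + f(t) - f(s)` for all `s` and `t`, where the integral is
required to exist. -/
def IsSolution (A : ℝ → E →L[ℝ] E) (f x : ℝ → E) : Prop :=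
  ∀ s t : ℝ, HasKSIntegral A x s t (x t - x s - (f t - f s))

/-- Condition (H): `I - Δ⁻A(t)` and `I + Δ⁺A(t)` are invertible for all `t`. -/
def ConditionH (A : ℝ → E →L[ℝ] E) : Prop :=
  ∀ t : ℝ, IsUnit (1 - (A t - Function.leftLim A t)) ∧
    IsUnit (1 + (Function.rightLim A t - A t))

/-- `U(t,s) = I + ∫_s^t d[A(r)] U(r,s)` for all `t` and `s`, read on each vector. -/
def IsTransitionMatrix (A : ℝ → E →L[ℝ] E) (U : ℝ → ℝ → E →L[ℝ] E) : Prop :=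
  ∀ (t s : ℝ) (v : E), HasKSIntegral A (fun r => U r s v) s t (U t s v - v)

open Classical in
/-- The transition matrix of `dx/dτ = D[A(t)x]` (with the junk value `0` where none exists). -/
def transitionMatrix (A : ℝ → E →L[ℝ] E) : ℝ → ℝ → E →L[ℝ] E :=
  if h : ∃ U, IsTransitionMatrix A U then h.choose else 0

/-- Exponential dichotomy on `ℝ` of `dx/dτ = D[A(t)x]`. -/
def HasExpDichotomy (A : ℝ → E →L[ℝ] E) : Prop :=
  ∃ (K α : ℝ) (P : E →L[ℝ] E), 0 < K ∧ 0 < α ∧ P * P = P ∧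
    (∀ t s : ℝ, s ≤ t →
      ‖transitionMatrix A t 0 * P * Ring.inverse (transitionMatrix A s 0)‖
        ≤ K * Real.exp (-α * (t - s))) ∧
    (∀ t s : ℝ, t ≤ s →
      ‖transitionMatrix A t 0 * (1 - P) * Ring.inverse (transitionMatrix A s 0)‖
        ≤ K * Real.exp (-α * (s - t)))

end GLDE

end

/-! The integral equation is replaced by a local condition. A monotone `M` is built that dominates
`A` and jumps on both sides of every discontinuity of `f`. Call `F` a primitive of `g` if F(v) -
F(τ) - (A(v) - A(τ))g(τ) = o(M(v) - M(τ)) as v → τ, for every τ. A mean value inequality, obtained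
from Cousin's lemma, makes primitives behave like antiderivatives: they are unique up to constants,
their increments are Kurzweil–Stieltjes integrals, and they exist for every regulated `g` whose
discontinuities sit at jumps of `M`. Hence `x` is a solution iff `x - f` is a primitive of `x`
(`isSolution_iff_isPrimitive`).

Where `M` varies by at most 1/2 on (a, b], integration is a contraction on functions with prescribed
value at `a`, which gives local existence. By (H) a homogeneous solution vanishes on both sides of a
point or on neither, which gives uniqueness; in finite dimension, injectivity of the map between
values at two points then lets any point serve as base point. This yields global solutions, the
transition matrix U and the rule U(t,r)U(r,s) = U(t,s).

Variation of constants (`IsTransitionMatrix.isPrimitive_variation`) says that s ↦ -U(ω,s)(x(s) -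
f(s) + f(0)) is a primitive of f - f(0) with respect to U(ω,·). So the integral J in the theorem
exists and equals U(ω,0)x(0) - x(ω) for every solution x. A solution is periodic iff x(ω) = x(0),
that is, iff (I - U(ω,0))x(0) = -J.

Finally, if U(ω,0)v = v, then U(kω,0)v = v for all integers k, and the dichotomy bounds both Pv and
(I - P)v by K exp(-αkω)‖v‖ for every k ≥ 0. So v = 0 and I - U(ω,0) is invertible. -/

namespace GLDE

variable {E : Type*} [NormedAddCommGroup E] [NormedSpace ℝ E]

/-! ### Cousin's lemma, Riemann sums and basic properties of the integral. -/

/-- Cousin's lemma as an induction principle: a transitive relation that holds between every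
point and its one-sided neighbours holds between the ends of an interval. -/
theorem cousin_induction {Q : ℝ → ℝ → Prop} {a b : ℝ} (hab : a < b)
    (trans : ∀ u v w, a ≤ u → u < v → v < w → w ≤ b → Q u v → Q v w → Q u w)
    (right : ∀ τ ∈ Set.Ico a b, ∀ᶠ v in 𝓝[>] τ, Q τ v)
    (left : ∀ τ ∈ Set.Ioc a b, ∀ᶠ u in 𝓝[<] τ, Q u τ) : Q a b := by
  set s : Set ℝ := {t | t ∈ Set.Icc a b ∧ (t = a ∨ Q a t)} with hs
  have has : a ∈ s := ⟨⟨le_rfl, hab.le⟩, Or.inl rfl⟩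
  have hbdd : BddAbove s := ⟨b, fun t ht => ht.1.2⟩
  set c := sSup s with hc
  have hac : a ≤ c := le_csSup hbdd has
  have hcb : c ≤ b := csSup_le ⟨a, has⟩ fun t ht => ht.1.2
  have hcs : c ∈ s := by
    rcases hac.eq_or_lt with h | h
    · exact h ▸ has
    -- The supremum `c` is attained: some `t` in `s` lies so close below `c` that `Q t c` holds, and
    -- transitivity does the rest.
    obtain ⟨l, hl, hlQ⟩ := mem_nhdsLT_iff_exists_Ioo_subset.1 (left c ⟨h, hcb⟩)
    obtain ⟨t, hts, ht⟩ := exists_lt_of_lt_csSup ⟨a, has⟩ (max_lt hl h)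
    have htc : t ≤ c := le_csSup hbdd hts
    rcases htc.eq_or_lt with h' | h'
    · exact h' ▸ hts
    have hat : a < t := (le_max_right _ _).trans_lt ht
    exact ⟨⟨hac, hcb⟩, Or.inr (trans a t c le_rfl hat h' hcb (hts.2.resolve_left hat.ne')
      (hlQ ⟨(le_max_left _ _).trans_lt ht, h'⟩))⟩
  rcases hcb.eq_or_lt with h | h
  · exact h ▸ hcs.2.resolve_left (h ▸ hab.ne')
  exfalso
  -- If `c < b`, the right-neighbour hypothesis at `c` produces a point of `s` beyond the supremum.
  obtain ⟨v, hv, hvQ⟩ := mem_nhdsGT_iff_exists_Ioo_subset.1 (right c ⟨hac, h⟩)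
  obtain ⟨w, hcw, hwv⟩ := exists_between (lt_min (show c < v from hv) h)
  have hQ : Q c w := hvQ ⟨hcw, hwv.trans_le (min_le_left _ _)⟩
  have hwb : w ≤ b := (hwv.trans_le (min_le_right _ _)).le
  have : w ∈ s := by
    refine ⟨⟨hac.trans hcw.le, hwb⟩, Or.inr ?_⟩
    rcases hcs.2 with h1 | h1
    · exact h1 ▸ hQ
    · rcases hac.eq_or_lt with h2 | h2
      · exact h2 ▸ hQ
      · exact trans a c w le_rfl h2 hcw hwb h1 hQ
  exact absurd (le_csSup hbdd this) (not_le.2 hcw)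

/-- `X` is the integral sum of some `δ`-fine tagged partition of `[a, b]`. -/
def IsRiemannSum (A : ℝ → E →L[ℝ] E) (g : ℝ → E) (δ : ℝ → ℝ) (a b : ℝ) (X : E) : Prop :=
  ∃ (ν : ℕ) (α τ : ℕ → ℝ), IsTaggedPartition a b ν α τ ∧ IsFine δ ν α τ ∧
    X = ∑ j ∈ Finset.range ν, (A (α (j + 1)) - A (α j)) (g (τ j))

variable {A : ℝ → E →L[ℝ] E} {g F : ℝ → E} {δ : ℝ → ℝ} {a b c : ℝ} {X Y : E}

theorem hasKSIntegralOn_iff : HasKSIntegralOn A g a b X ↔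
    ∀ ε > 0, ∃ δ : ℝ → ℝ, (∀ t ∈ Set.Icc a b, 0 < δ t) ∧
      ∀ Y, IsRiemannSum A g δ a b Y → ‖Y - X‖ < ε := by
  refine forall₂_congr fun ε _ => exists_congr fun δ => and_congr_right fun _ => ⟨?_, ?_⟩
  · rintro h Y ⟨ν, α, τ, h1, h2, rfl⟩
    exact h ν α τ h1 h2
  · exact fun h ν α τ h1 h2 => h _ ⟨ν, α, τ, h1, h2, rfl⟩

theorem IsRiemannSum.refl (a : ℝ) : IsRiemannSum A g δ a a 0 :=
  ⟨0, fun _ => a, fun _ => a, ⟨rfl, rfl, by simp⟩, fun j hj => by simp at hj, by simp⟩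

theorem IsRiemannSum.single {t : ℝ} (hab : a < b) (ht : t ∈ Set.Icc a b)
    (hδ : Set.Icc a b ⊆ Set.Ioo (t - δ t) (t + δ t)) :
    IsRiemannSum A g δ a b ((A b - A a) (g t)) := by
  refine ⟨1, fun j => if j = 0 then a else b, fun _ => t, ⟨by simp, by simp, ?_⟩, ?_, by simp⟩
  · intro j hj
    obtain rfl : j = 0 := by omega
    simpa using ⟨hab, ht⟩
  · intro j hj
    obtain rfl : j = 0 := by omega
    simpa using hδ

theorem IsRiemannSum.mono {δ' : ℝ → ℝ} (h : IsRiemannSum A g δ a b X) (hδ : ∀ t, δ t ≤ δ' t) :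
    IsRiemannSum A g δ' a b X := by
  obtain ⟨ν, α, τ, h1, h2, rfl⟩ := h
  refine ⟨ν, α, τ, h1, fun j hj => (h2 j hj).trans (Set.Ioo_subset_Ioo ?_ ?_), rfl⟩ <;>
    linarith [hδ (τ j)]

theorem IsRiemannSum.append (h : IsRiemannSum A g δ a b X) (h' : IsRiemannSum A g δ b c Y) :
    IsRiemannSum A g δ a c (X + Y) := by
  obtain ⟨ν, α, τ, ⟨h0, h1, h2⟩, h3, rfl⟩ := h
  obtain ⟨ν', α', τ', ⟨h0', h1', h2'⟩, h3', rfl⟩ := h'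
  set β : ℕ → ℝ := fun j => if j ≤ ν then α j else α' (j - ν) with hβ
  set σ : ℕ → ℝ := fun j => if j < ν then τ j else τ' (j - ν) with hσ
  have e1 : ∀ j < ν, β j = α j ∧ β (j + 1) = α (j + 1) ∧ σ j = τ j := fun j hj => by
    simp only [hβ, hσ]
    exact ⟨if_pos hj.le, if_pos hj, if_pos hj⟩
  have e2 : ∀ j, β (ν + j) = α' j := fun j => by
    simp only [hβ]
    rcases Nat.eq_zero_or_pos j with rfl | hj
    · simp [h1, h0']
    · rw [if_neg (by omega)]; simp
  have e3 : ∀ j, σ (ν + j) = τ' j := fun j => by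
    simp only [hσ]
    rw [if_neg (by omega)]; simp
  have key : ∀ j < ν + ν', j < ν ∨ ∃ k < ν', j = ν + k := fun j hj => by
    rcases lt_or_ge j ν with h | h
    · exact Or.inl h
    · exact Or.inr ⟨j - ν, by omega, by omega⟩
  refine ⟨ν + ν', β, σ, ⟨by simp [hβ, h0], by rw [e2, h1'], ?_⟩, ?_, ?_⟩
  · intro j hj
    rcases key j hj with h | ⟨k, hk, rfl⟩
    · obtain ⟨p, q, r⟩ := e1 j h
      rw [p, q, r]; exact h2 j h
    · rw [add_assoc, e2, e2, e3]; exact h2' k hk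
  · intro j hj
    rcases key j hj with h | ⟨k, hk, rfl⟩
    · obtain ⟨p, q, r⟩ := e1 j h
      rw [p, q, r]; exact h3 j h
    · rw [add_assoc, e2, e2, e3]; exact h3' k hk
  · rw [Finset.sum_range_add]
    congr 1
    · refine Finset.sum_congr rfl fun j hj => ?_
      obtain ⟨p, q, r⟩ := e1 j (Finset.mem_range.1 hj)
      rw [p, q, r]
    · refine Finset.sum_congr rfl fun j _ => ?_
      rw [add_assoc, e2, e2, e3]

/-- Reversing the order of the points changes the sign of each increment of `A`. Reflection lets
later arguments treat only one side of a point. -/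
theorem IsRiemannSum.reflect (h : IsRiemannSum A g δ a b X) :
    IsRiemannSum (fun t => A (-t)) (fun t => g (-t)) (fun t => δ (-t)) (-b) (-a) (-X) := by
  obtain ⟨ν, α, τ, ⟨h0, h1, h2⟩, h3, rfl⟩ := h
  -- Reversal sends the points to indices `ν - j` and the tags to `ν - 1 - j`; the identities hold
  -- for truncated subtraction because `j < ν`.
  have e : ∀ j < ν, ν - j = (ν - 1 - j) + 1 ∧ ν - (j + 1) = ν - 1 - j ∧ ν - 1 - j < ν :=
    fun j hj => ⟨by omega, by omega, by omega⟩
  refine ⟨ν, fun j => -α (ν - j), fun j => -τ (ν - 1 - j), ⟨by simp [h1], by simp [h0], ?_⟩, ?_, ?_⟩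
  · intro j hj
    obtain ⟨p, q, r⟩ := e j hj
    obtain ⟨k1, k2, k3⟩ := h2 _ r
    simp only [p, q, Set.mem_Icc, neg_le_neg_iff, neg_lt_neg_iff]
    exact ⟨k1, k3, k2⟩
  · intro j hj
    obtain ⟨p, q, r⟩ := e j hj
    intro t ht
    simp only [p, q, Set.mem_Icc] at ht
    have := h3 _ r (show -t ∈ Set.Icc (α (ν - 1 - j)) (α (ν - 1 - j + 1)) from
      ⟨by linarith [ht.2], by linarith [ht.1]⟩)
    simp only [neg_neg, Set.mem_Ioo] at this ⊢
    constructor <;> linarith [this.1, this.2]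
  · rw [← Finset.sum_range_reflect, ← Finset.sum_neg_distrib]
    refine Finset.sum_congr rfl fun j hj => ?_
    obtain ⟨p, q, r⟩ := e j (Finset.mem_range.1 hj)
    simp only [p, q, neg_neg]
    simp

/-- Only increments of `A` enter a sum, so invariance of the increments suffices; `A` itself need
not be periodic. -/
theorem IsRiemannSum.translate {ω : ℝ} (hA : ∀ s t, A (t + ω) - A (s + ω) = A t - A s)
    (h : IsRiemannSum A (fun t => g (t + ω)) (fun t => δ (t + ω)) a b X) :
    IsRiemannSum A g δ (a + ω) (b + ω) X := by
  obtain ⟨ν, α, τ, ⟨h0, h1, h2⟩, h3, rfl⟩ := h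
  refine ⟨ν, fun j => α j + ω, fun j => τ j + ω, ⟨by simp [h0], by simp [h1], ?_⟩, ?_, ?_⟩
  · intro j hj
    have := h2 j hj
    simpa using this
  · intro j hj t ht
    have := h3 j hj (show t - ω ∈ Set.Icc (α j) (α (j + 1)) from
      ⟨by linarith [ht.1], by linarith [ht.2]⟩)
    constructor <;> linarith [this.1, this.2]
  · simp [hA]

theorem exists_isRiemannSum (A : ℝ → E →L[ℝ] E) (g : ℝ → E) (hab : a ≤ b)
    (hδ : ∀ t ∈ Set.Icc a b, 0 < δ t) : ∃ X, IsRiemannSum A g δ a b X := by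
  rcases hab.eq_or_lt with rfl | hab
  · exact ⟨0, .refl a⟩
  refine cousin_induction (Q := fun u v => ∃ X, IsRiemannSum A g δ u v X) hab ?_ ?_ ?_
  · rintro u v w - - - - ⟨X, hX⟩ ⟨Y, hY⟩
    exact ⟨_, hX.append hY⟩
  · intro t ht
    have hp := hδ t ⟨ht.1, ht.2.le⟩
    filter_upwards [Ioo_mem_nhdsGT (show t < t + δ t by linarith)] with v hv
    exact ⟨_, .single hv.1 ⟨le_rfl, hv.1.le⟩ fun r hr => ⟨by linarith [hr.1], by
      linarith [hr.2, hv.2]⟩⟩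
  · intro t ht
    have hp := hδ t ⟨ht.1.le, ht.2⟩
    filter_upwards [Ioo_mem_nhdsLT (show t - δ t < t by linarith)] with v hv
    exact ⟨_, .single hv.2 ⟨hv.2.le, le_rfl⟩ fun r hr => ⟨by linarith [hr.1, hv.1], by
      linarith [hr.2]⟩⟩

theorem HasKSIntegralOn.unique (hab : a ≤ b) (h : HasKSIntegralOn A g a b X)
    (h' : HasKSIntegralOn A g a b Y) : X = Y := by
  rw [hasKSIntegralOn_iff] at h h'
  refine eq_of_forall_dist_le fun ε hε => ?_
  obtain ⟨δ, hδ, H⟩ := h (ε / 2) (by positivity)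
  obtain ⟨δ', hδ', H'⟩ := h' (ε / 2) (by positivity)
  obtain ⟨Z, hZ⟩ := exists_isRiemannSum (δ := fun t => min (δ t) (δ' t)) A g hab
    fun t ht => lt_min (hδ t ht) (hδ' t ht)
  have h1 := H Z (hZ.mono fun t => min_le_left _ _)
  have h2 := H' Z (hZ.mono fun t => min_le_right _ _)
  rw [dist_eq_norm, show X - Y = (Z - Y) - (Z - X) by abel]
  linarith [norm_sub_le (Z - Y) (Z - X)]

theorem HasKSIntegral.unique (h : HasKSIntegral A g a b X) (h' : HasKSIntegral A g a b Y) :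
    X = Y := by
  rcases le_total a b with hab | hab
  · exact (h.1 hab).unique hab (h'.1 hab)
  · exact neg_injective ((h.2 hab).unique hab (h'.2 hab))

theorem HasKSIntegralOn.reflect (h : HasKSIntegralOn A g a b X) :
    HasKSIntegralOn (fun t => A (-t)) (fun t => g (-t)) (-b) (-a) (-X) := by
  rw [hasKSIntegralOn_iff] at h ⊢
  intro ε hε
  obtain ⟨δ, hδ, H⟩ := h ε hε
  refine ⟨fun t => δ (-t), fun t ht => hδ _ ⟨by linarith [ht.2], by linarith [ht.1]⟩, ?_⟩
  intro Y hY
  have := H (-Y) (by simpa using hY.reflect)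
  rwa [← norm_neg, show -(Y - -X) = -Y - X by abel]

theorem HasKSIntegralOn.translate {ω : ℝ} (hA : ∀ s t, A (t + ω) - A (s + ω) = A t - A s)
    (h : HasKSIntegralOn A g (a + ω) (b + ω) X) :
    HasKSIntegralOn A (fun t => g (t + ω)) a b X := by
  rw [hasKSIntegralOn_iff] at h ⊢
  intro ε hε
  obtain ⟨δ, hδ, H⟩ := h ε hε
  exact ⟨fun t => δ (t + ω), fun t ht => hδ _ ⟨by linarith [ht.1], by linarith [ht.2]⟩,
    fun Y hY => H Y (hY.translate hA)⟩

theorem HasKSIntegral.translate {ω : ℝ} (hA : ∀ s t, A (t + ω) - A (s + ω) = A t - A s)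
    (h : HasKSIntegral A g (a + ω) (b + ω) X) :
    HasKSIntegral A (fun t => g (t + ω)) a b X :=
  ⟨fun hab => (h.1 (by linarith)).translate hA, fun hab => (h.2 (by linarith)).translate hA⟩

/-! ### One-sided jumps of indefinite integrals. -/

/-- Left jump of an indefinite integral. -/
theorem tendsto_residual_left
    (h : ∀ t ∈ Set.Icc a b, HasKSIntegralOn A g a t (F t - F a)) {τ : ℝ} (hτ : τ ∈ Set.Ioc a b) :
    Tendsto (fun v => F v - F τ - (A v - A τ) (g τ)) (𝓝[<] τ) (𝓝 0) := by
  refine Metric.tendsto_nhds.2 fun ε hε => ?_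
  obtain ⟨δ, hδ, H⟩ := hasKSIntegralOn_iff.1 (h τ ⟨hτ.1.le, hτ.2⟩) (ε / 2) (by positivity)
  have hp := hδ τ ⟨hτ.1.le, le_rfl⟩
  filter_upwards [Ioo_mem_nhdsLT (show max a (τ - δ τ) < τ from max_lt hτ.1 (by linarith))]
    with v hv
  have hav : a < v := (le_max_left _ _).trans_lt hv.1
  have hδv : τ - δ τ < v := (le_max_right _ _).trans_lt hv.1
  obtain ⟨δ', hδ', H'⟩ := hasKSIntegralOn_iff.1 (h v ⟨hav.le, hv.2.le.trans hτ.2⟩) (ε / 2)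
    (by positivity)
  -- One sum over [a, v] serves both integrals; extended by [v, τ] with tag τ it is fine for the
  -- integral up to τ.
  obtain ⟨Z, hZ⟩ := exists_isRiemannSum (δ := fun t => min (δ t) (δ' t)) A g hav.le
    fun t ht => lt_min (hδ t ⟨ht.1, ht.2.trans hv.2.le⟩) (hδ' t ht)
  have h1 := H' Z (hZ.mono fun t => min_le_right _ _)
  have h2 := H _ ((hZ.mono fun t => min_le_left _ _).append
    (.single hv.2 ⟨hv.2.le, le_rfl⟩ fun r hr => ⟨by linarith [hr.1], by linarith [hr.2]⟩))
  rw [dist_zero_right, show F v - F τ - (A v - A τ) (g τ) =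
    (Z + (A τ - A v) (g τ) - (F τ - F a)) - (Z - (F v - F a)) by
      simp only [_root_.sub_apply]; abel]
  exact (norm_sub_le _ _).trans_lt (by linarith)

/-- Right jump of an indefinite integral. -/
theorem tendsto_residual_right
    (h : ∀ t ∈ Set.Icc a b, HasKSIntegralOn A g a t (F t - F a)) {τ : ℝ} (hτ : τ ∈ Set.Ico a b) :
    Tendsto (fun v => F v - F τ - (A v - A τ) (g τ)) (𝓝[>] τ) (𝓝 0) := by
  refine Metric.tendsto_nhds.2 fun ε hε => ?_
  have hab : a ≤ b := hτ.1.trans hτ.2.le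
  obtain ⟨δ, hδ, H⟩ := hasKSIntegralOn_iff.1 (h b ⟨hab, le_rfl⟩) (ε / 4) (by positivity)
  have hp := hδ τ ⟨hτ.1, hτ.2.le⟩
  obtain ⟨δ₁, hδ₁, H₁⟩ := hasKSIntegralOn_iff.1 (h τ ⟨hτ.1, hτ.2.le⟩) (ε / 4) (by positivity)
  obtain ⟨Z₁, hZ₁⟩ := exists_isRiemannSum (δ := fun t => min (δ t) (δ₁ t)) A g hτ.1
    fun t ht => lt_min (hδ t ⟨ht.1, ht.2.trans hτ.2.le⟩) (hδ₁ t ht)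
  have h1 := H₁ Z₁ (hZ₁.mono fun t => min_le_right _ _)
  filter_upwards [Ioo_mem_nhdsGT (show τ < min b (τ + δ τ) from lt_min hτ.2 (by linarith))]
    with v hv
  have hvb : v < b := hv.2.trans_le (min_le_left _ _)
  have hδv : v < τ + δ τ := hv.2.trans_le (min_le_right _ _)
  have hav : a ≤ v := hτ.1.trans hv.1.le
  obtain ⟨δ₂, hδ₂, H₂⟩ := hasKSIntegralOn_iff.1 (h v ⟨hav, hvb.le⟩) (ε / 4) (by positivity)
  obtain ⟨Z₂, hZ₂⟩ := exists_isRiemannSum (δ := fun t => min (δ t) (δ₂ t)) A g hav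
    fun t ht => lt_min (hδ t ⟨ht.1, ht.2.trans hvb.le⟩) (hδ₂ t ht)
  -- Two fine sums over [a, b] share the tail `Z₃` over [v, b]; comparing them isolates the term of
  -- [τ, v] with tag τ.
  obtain ⟨Z₃, hZ₃⟩ := exists_isRiemannSum (δ := δ) A g hvb.le
    fun t ht => hδ t ⟨hav.trans ht.1, ht.2⟩
  have h2 := H₂ Z₂ (hZ₂.mono fun t => min_le_right _ _)
  have h3 := H _ ((hZ₂.mono fun t => min_le_left _ _).append hZ₃)
  have h4 := H _ (((hZ₁.mono fun t => min_le_left _ _).append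
    (.single hv.1 ⟨le_rfl, hv.1.le⟩
      fun r hr => ⟨by linarith [hr.1], by linarith [hr.2]⟩)).append hZ₃)
  rw [dist_zero_right, show F v - F τ - (A v - A τ) (g τ) =
    (Z₁ - (F τ - F a)) - (Z₂ - (F v - F a)) + (Z₂ + Z₃ - (F b - F a))
      - (Z₁ + (A v - A τ) (g τ) + Z₃ - (F b - F a)) by abel]
  refine (norm_sub_le _ _).trans_lt ?_
  linarith [norm_add_le ((Z₁ - (F τ - F a)) - (Z₂ - (F v - F a))) (Z₂ + Z₃ - (F b - F a)),
    norm_sub_le (Z₁ - (F τ - F a)) (Z₂ - (F v - F a))]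

end GLDE

/-! ### Primitives relative to a monotone function. -/

namespace GLDE

variable {E : Type*} [NormedAddCommGroup E] [NormedSpace ℝ E]

/-- `F` is a primitive of `g` on `S` with respect to `A` up to an error of local slope `ε`
relative to `M`. -/
def IsApproxPrimitive (ε : ℝ) (M : ℝ → ℝ) (A : ℝ → E →L[ℝ] E) (g F : ℝ → E) (S : Set ℝ) : Prop :=
  ∀ τ ∈ S, ∀ᶠ v in 𝓝[S] τ, ‖F v - F τ - (A v - A τ) (g τ)‖ ≤ ε * |M v - M τ|

/-- `F` is a primitive of `g` on `S` with respect to `A`: the increments of `F` at `τ` agree with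
those of `A` applied to `g τ`, up to `o(M v - M τ)`. -/
def IsPrimitive (M : ℝ → ℝ) (A : ℝ → E →L[ℝ] E) (g F : ℝ → E) (S : Set ℝ) : Prop :=
  ∀ ε > 0, IsApproxPrimitive ε M A g F S

variable {M : ℝ → ℝ} {A : ℝ → E →L[ℝ] E} {g g' F F' : ℝ → E} {S T : Set ℝ} {ε ε' a b c : ℝ}

theorem IsApproxPrimitive.mono_set (h : IsApproxPrimitive ε M A g F S) (hT : T ⊆ S) :
    IsApproxPrimitive ε M A g F T :=
  fun τ hτ => (h τ (hT hτ)).filter_mono (nhdsWithin_mono τ hT)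

theorem IsPrimitive.mono_set (h : IsPrimitive M A g F S) (hT : T ⊆ S) : IsPrimitive M A g F T :=
  fun ε hε => (h ε hε).mono_set hT

theorem IsApproxPrimitive.congr (h : IsApproxPrimitive ε M A g F S) (hg : Set.EqOn g g' S)
    (hF : Set.EqOn F F' S) : IsApproxPrimitive ε M A g' F' S := by
  intro τ hτ
  filter_upwards [h τ hτ, self_mem_nhdsWithin] with v hv hvS
  rwa [← hF hvS, ← hF hτ, ← hg hτ]

theorem IsPrimitive.congr (h : IsPrimitive M A g F S) (hg : Set.EqOn g g' S)
    (hF : Set.EqOn F F' S) : IsPrimitive M A g' F' S :=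
  fun ε hε => (h ε hε).congr hg hF

theorem IsApproxPrimitive.add (h : IsApproxPrimitive ε M A g F S)
    (h' : IsApproxPrimitive ε' M A g' F' S) :
    IsApproxPrimitive (ε + ε') M A (fun t => g t + g' t) (fun t => F t + F' t) S := by
  intro τ hτ
  filter_upwards [h τ hτ, h' τ hτ] with v h1 h2
  rw [map_add, add_mul]
  refine le_trans (le_of_eq ?_) ((norm_add_le _ _).trans (add_le_add h1 h2))
  congr 1; abel

theorem IsPrimitive.add (h : IsPrimitive M A g F S) (h' : IsPrimitive M A g' F' S) :
    IsPrimitive M A (fun t => g t + g' t) (fun t => F t + F' t) S := by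
  intro ε hε
  have := (h (ε / 2) (half_pos hε)).add (h' (ε / 2) (half_pos hε))
  rwa [add_halves] at this

theorem IsApproxPrimitive.smul (h : IsApproxPrimitive ε M A g F S) (r : ℝ) :
    IsApproxPrimitive (|r| * ε) M A (fun t => r • g t) (fun t => r • F t) S := by
  intro τ hτ
  filter_upwards [h τ hτ] with v h1
  rw [map_smul, ← smul_sub, ← smul_sub, norm_smul, Real.norm_eq_abs, mul_assoc]
  exact mul_le_mul_of_nonneg_left h1 (abs_nonneg _)

theorem IsPrimitive.smul (h : IsPrimitive M A g F S) (r : ℝ) :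
    IsPrimitive M A (fun t => r • g t) (fun t => r • F t) S := by
  intro ε hε τ hτ
  filter_upwards [(h (ε / (|r| + 1)) (by positivity)).smul r τ hτ] with v h1
  refine h1.trans (mul_le_mul_of_nonneg_right ?_ (abs_nonneg _))
  rw [mul_div_assoc', div_le_iff₀ (by positivity)]
  nlinarith [abs_nonneg r]

theorem IsApproxPrimitive.sub (h : IsApproxPrimitive ε M A g F S)
    (h' : IsApproxPrimitive ε' M A g' F' S) :
    IsApproxPrimitive (ε + ε') M A (fun t => g t - g' t) (fun t => F t - F' t) S := by
  simpa [sub_eq_add_neg] using h.add (h'.smul (-1))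

theorem IsPrimitive.sub (h : IsPrimitive M A g F S) (h' : IsPrimitive M A g' F' S) :
    IsPrimitive M A (fun t => g t - g' t) (fun t => F t - F' t) S := by
  simpa [sub_eq_add_neg] using h.add (h'.smul (-1))

theorem IsPrimitive.add_const (h : IsPrimitive M A g F S) (y : E) :
    IsPrimitive M A g (fun t => F t + y) S := by
  intro ε hε τ hτ
  filter_upwards [h ε hε τ hτ] with v hv
  simpa using hv

theorem IsApproxPrimitive.glue (h : IsApproxPrimitive ε M A g F (Set.Icc a b))
    (h' : IsApproxPrimitive ε M A g F (Set.Icc b c)) :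
    IsApproxPrimitive ε M A g F (Set.Icc a c) := by
  -- For `τ` outside the closed interval the filter is trivial, so the estimate may be used at every
  -- `τ`.
  have key : ∀ {u v : ℝ}, IsApproxPrimitive ε M A g F (Set.Icc u v) → ∀ τ, ∀ᶠ v in 𝓝[Set.Icc u v] τ,
      ‖F v - F τ - (A v - A τ) (g τ)‖ ≤ ε * |M v - M τ| := by
    intro u v H τ
    by_cases hτ : τ ∈ Set.Icc u v
    · exact H τ hτ
    · rw [← isClosed_Icc.closure_eq, mem_closure_iff_nhdsWithin_neBot, not_neBot] at hτ
      simp [hτ]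
  intro τ _
  have : 𝓝[Set.Icc a c] τ ≤ 𝓝[Set.Icc a b] τ ⊔ 𝓝[Set.Icc b c] τ := by
    rw [← nhdsWithin_union]
    exact nhdsWithin_mono _ Set.Icc_subset_Icc_union_Icc
  exact (eventually_sup.2 ⟨key h τ, key h' τ⟩).filter_mono this

theorem IsPrimitive.glue (h : IsPrimitive M A g F (Set.Icc a b))
    (h' : IsPrimitive M A g F (Set.Icc b c)) : IsPrimitive M A g F (Set.Icc a c) :=
  fun ε hε => (h ε hε).glue (h' ε hε)

theorem IsPrimitive.univ (h : ∀ a b, IsPrimitive M A g F (Set.Icc a b)) :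
    IsPrimitive M A g F Set.univ := by
  intro ε hε τ _
  have := h (τ - 1) (τ + 1) ε hε τ ⟨by linarith, by linarith⟩
  rwa [nhdsWithin_univ, ← nhdsWithin_eq_nhds.2
    (Icc_mem_nhds (by linarith : τ - 1 < τ) (by linarith : τ < τ + 1))]

theorem IsPrimitive.reflect (h : IsPrimitive M A g F (Set.Icc a b)) :
    IsPrimitive (fun t => -M (-t)) (fun t => A (-t)) (fun t => g (-t)) (fun t => F (-t))
      (Set.Icc (-b) (-a)) := by
  intro ε hε τ hτ
  have ht : Tendsto (fun t : ℝ => -t) (𝓝[Set.Icc (-b) (-a)] τ) (𝓝[Set.Icc a b] (-τ)) :=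
    tendsto_nhdsWithin_iff.2 ⟨(continuous_neg.tendsto τ).mono_left nhdsWithin_le_nhds,
      eventually_of_mem self_mem_nhdsWithin fun t ht => ⟨by linarith [ht.2], by linarith [ht.1]⟩⟩
  filter_upwards [ht.eventually (h ε hε (-τ) ⟨by linarith [hτ.2], by linarith [hτ.1]⟩)] with v hv
  rwa [show -M (-v) - -M (-τ) = -(M (-v) - M (-τ)) by ring, abs_neg]

theorem nhdsGT_le_nhdsWithin_Icc {τ : ℝ} (hτ : τ ∈ Set.Ico a b) : 𝓝[>] τ ≤ 𝓝[Set.Icc a b] τ := by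
  rw [← nhdsWithin_Ioo_eq_nhdsGT hτ.2]
  exact nhdsWithin_mono _ fun t ht => ⟨hτ.1.trans ht.1.le, ht.2.le⟩

theorem nhdsLT_le_nhdsWithin_Icc {τ : ℝ} (hτ : τ ∈ Set.Ioc a b) : 𝓝[<] τ ≤ 𝓝[Set.Icc a b] τ := by
  rw [← nhdsWithin_Ioo_eq_nhdsLT hτ.1]
  exact nhdsWithin_mono _ fun t ht => ⟨ht.1.le, ht.2.le.trans hτ.2⟩

theorem eventually_nhdsWithin_Icc {P : ℝ → Prop} {τ : ℝ} (h : P τ)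
    (hr : τ < b → ∀ᶠ s in 𝓝[>] τ, P s) (hl : a < τ → ∀ᶠ s in 𝓝[<] τ, P s) :
    ∀ᶠ s in 𝓝[Set.Icc a b] τ, P s := by
  have h1 : ∀ᶠ s in 𝓝 τ, τ < s → s ≤ b → P s := by
    rcases lt_or_ge τ b with hb | hb
    · filter_upwards [eventually_nhdsWithin_iff.1 (hr hb)] with s hs h1 _ using hs h1
    · exact Eventually.of_forall fun s h1 h2 => absurd (h1.trans_le h2) (not_lt.2 hb)
  have h2 : ∀ᶠ s in 𝓝 τ, s < τ → a ≤ s → P s := by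
    rcases lt_or_ge a τ with hb | hb
    · filter_upwards [eventually_nhdsWithin_iff.1 (hl hb)] with s hs h1 _ using hs h1
    · exact Eventually.of_forall fun s h1 h2 => absurd (h2.trans_lt h1) (not_lt.2 hb)
  refine eventually_nhdsWithin_iff.2 ?_
  filter_upwards [h1, h2] with s h1 h2 hs
  rcases lt_trichotomy s τ with h' | rfl | h'
  · exact h2 h' hs.1
  · exact h
  · exact h1 h' hs.2

/-- Mean value inequality relative to a monotone function. -/
theorem norm_sub_le_of_eventually {X : Type*} [NormedAddCommGroup X] {G : ℝ → X} {K : ℝ} (hM : Monotone M)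
    (h : ∀ τ ∈ Set.Icc a b, ∀ᶠ s in 𝓝[Set.Icc a b] τ, ‖G s - G τ‖ ≤ K * |M s - M τ|)
    {s t : ℝ} (hs : s ∈ Set.Icc a b) (ht : t ∈ Set.Icc a b) :
    ‖G t - G s‖ ≤ K * |M t - M s| := by
  wlog hst : s ≤ t generalizing s t
  · rw [norm_sub_rev, abs_sub_comm]
    exact this ht hs (le_of_not_ge hst)
  rcases hst.eq_or_lt with rfl | hst
  · simp
  refine cousin_induction (Q := fun u v => ‖G v - G u‖ ≤ K * |M v - M u|) hst ?_ ?_ ?_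
  · intro u v w _ huv hvw _ h1 h2
    rw [abs_of_nonneg (sub_nonneg.2 (hM huv.le))] at h1
    rw [abs_of_nonneg (sub_nonneg.2 (hM hvw.le))] at h2
    rw [abs_of_nonneg (sub_nonneg.2 (hM (huv.trans hvw).le))]
    have := norm_add_le (G w - G v) (G v - G u)
    rw [sub_add_sub_cancel] at this
    linarith
  · intro τ hτ
    exact (h τ ⟨hs.1.trans hτ.1, hτ.2.le.trans ht.2⟩).filter_mono
      (nhdsGT_le_nhdsWithin_Icc ⟨hs.1.trans hτ.1, hτ.2.trans_le ht.2⟩)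
  · intro τ hτ
    filter_upwards [(h τ ⟨hs.1.trans hτ.1.le, hτ.2.trans ht.2⟩).filter_mono
      (nhdsLT_le_nhdsWithin_Icc ⟨hs.1.trans_lt hτ.1, hτ.2.trans ht.2⟩)] with u hu
    rwa [norm_sub_rev, abs_sub_comm]

/-- `A` has increments bounded by those of the monotone function `M`. -/
def IsDominated {X : Type*} [NormedAddCommGroup X] (M : ℝ → ℝ) (A : ℝ → X) : Prop :=
  ∀ s t, ‖A t - A s‖ ≤ |M t - M s|

theorem IsApproxPrimitive.norm_sub_le (hM : Monotone M) (hA : IsDominated M A)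
    (h : IsApproxPrimitive ε M A g F (Set.Icc a b)) {D : ℝ} (hg : ∀ t ∈ Set.Icc a b, ‖g t‖ ≤ D)
    {s t : ℝ} (hs : s ∈ Set.Icc a b) (ht : t ∈ Set.Icc a b) :
    ‖F t - F s‖ ≤ (D + ε) * |M t - M s| := by
  refine norm_sub_le_of_eventually hM (fun τ hτ => ?_) hs ht
  filter_upwards [h τ hτ] with v hv
  have h1 : ‖(A v - A τ) (g τ)‖ ≤ D * |M v - M τ| := by
    rw [mul_comm]
    exact ((A v - A τ).le_opNorm _).trans
      (mul_le_mul (hA τ v) (hg τ hτ) (norm_nonneg _) (abs_nonneg _))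
  rw [show F v - F τ = (F v - F τ - (A v - A τ) (g τ)) + (A v - A τ) (g τ) by abel]
  refine (norm_add_le _ _).trans ?_
  linarith

theorem IsPrimitive.norm_sub_le (hM : Monotone M) (hA : IsDominated M A)
    (h : IsPrimitive M A g F (Set.Icc a b)) {D : ℝ} (hg : ∀ t ∈ Set.Icc a b, ‖g t‖ ≤ D)
    {s t : ℝ} (hs : s ∈ Set.Icc a b) (ht : t ∈ Set.Icc a b) :
    ‖F t - F s‖ ≤ D * |M t - M s| := by
  have hlim : Tendsto (fun ε : ℝ => (D + ε) * |M t - M s|) (𝓝[>] 0) (𝓝 ((D + 0) * |M t - M s|)) :=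
    ((continuous_const.add continuous_id).mul continuous_const).continuousWithinAt
  rw [add_zero] at hlim
  refine ge_of_tendsto hlim ?_
  filter_upwards [self_mem_nhdsWithin] with ε hε
  exact (h ε hε).norm_sub_le hM hA hg hs ht

/-- The common term (A(v) - A(τ))g(τ) cancels in the difference. This is the uniqueness of
antiderivatives up to constants in quantitative form; it makes approximate primitives a Cauchy
sequence. -/
theorem IsApproxPrimitive.norm_sub_sub_le (hM : Monotone M)
    (h : IsApproxPrimitive ε M A g F (Set.Icc a b)) (h' : IsApproxPrimitive ε' M A g F' (Set.Icc a b))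
    {s t : ℝ} (hs : s ∈ Set.Icc a b) (ht : t ∈ Set.Icc a b) :
    ‖(F t - F' t) - (F s - F' s)‖ ≤ (ε + ε') * |M t - M s| := by
  refine norm_sub_le_of_eventually (G := fun t => F t - F' t) hM (fun τ hτ => ?_) hs ht
  filter_upwards [h.sub h' τ hτ] with v hv
  simpa using hv

theorem isTaggedPartition_le {ν : ℕ} {α τ : ℕ → ℝ} (h : IsTaggedPartition a b ν α τ) :
    ∀ j ≤ ν, a ≤ α j ∧ α j ≤ b := by
  obtain ⟨h0, h1, h2⟩ := h
  have up : ∀ j ≤ ν, a ≤ α j := by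
    intro j
    induction j with
    | zero => intro _; exact h0.ge
    | succ k ih => intro hk; exact (ih (by omega)).trans (h2 k hk).1.le
  have dn : ∀ j ≤ ν, α (ν - j) ≤ b := by
    intro j
    induction j with
    | zero => intro _; exact h1.le
    | succ k ih =>
      intro hk
      have := (h2 (ν - (k + 1)) (by omega)).1
      rw [show ν - (k + 1) + 1 = ν - k by omega] at this
      exact this.le.trans (ih (by omega))
  intro j hj
  refine ⟨up j hj, ?_⟩
  have := dn (ν - j) (by omega)
  rwa [show ν - (ν - j) = j by omega] at this

/-- The local `o(M v - M τ)` estimate supplies the gauge, and the errors over a fine partition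
telescope to a small multiple of `M b - M a`. -/
theorem IsPrimitive.hasKSIntegralOn (hM : Monotone M) (h : IsPrimitive M A g F (Set.Icc a b)) :
    HasKSIntegralOn A g a b (F b - F a) := by
  intro ε hε
  rcases lt_or_ge b a with hab | hab
  · refine ⟨fun _ => 1, fun _ _ => one_pos, fun ν α τ h1 _ => ?_⟩
    have := isTaggedPartition_le h1 0 (Nat.zero_le _)
    linarith
  have hMab : 0 ≤ M b - M a := sub_nonneg.2 (hM hab)
  -- The `+ 1` covers the case of constant `M` and makes the final inequality strict.
  set η := ε / (M b - M a + 1) with hη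
  have hη0 : 0 < η := by positivity
  have hex : ∀ τ, ∃ δ > 0, τ ∈ Set.Icc a b → ∀ v ∈ Set.Icc a b, |v - τ| < δ →
      ‖F v - F τ - (A v - A τ) (g τ)‖ ≤ η * |M v - M τ| := by
    intro τ
    by_cases hτ : τ ∈ Set.Icc a b
    · obtain ⟨δ, hδ, H⟩ := Metric.mem_nhdsWithin_iff.1 (h η hη0 τ hτ)
      exact ⟨δ, hδ, fun _ v hv hvτ => H ⟨hvτ, hv⟩⟩
    · exact ⟨1, one_pos, fun h => absurd h hτ⟩
  choose δ hδ H using hex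
  refine ⟨δ, fun t _ => hδ t, fun ν α τ h1 h2 => ?_⟩
  have hmem := isTaggedPartition_le h1
  have hterm : ∀ j ∈ Finset.range ν, ‖(A (α (j + 1)) - A (α j)) (g (τ j)) - (F (α (j + 1)) - F (α j))‖
      ≤ η * (M (α (j + 1)) - M (α j)) := by
    intro j hj
    have hj := Finset.mem_range.1 hj
    obtain ⟨hlt, htag⟩ := h1.2.2 j hj
    have hτ : τ j ∈ Set.Icc a b :=
      ⟨(hmem j hj.le).1.trans htag.1, htag.2.trans (hmem (j + 1) hj).2⟩
    have f1 := h2 j hj (Set.left_mem_Icc.2 hlt.le)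
    have f2 := h2 j hj (Set.right_mem_Icc.2 hlt.le)
    have k1 := H _ hτ _ (hmem j hj.le) (abs_lt.2 ⟨by linarith [f1.1], by linarith [f1.2]⟩)
    have k2 := H _ hτ _ (hmem (j + 1) hj) (abs_lt.2 ⟨by linarith [f2.1], by linarith [f2.2]⟩)
    -- The tag lies between the endpoints, so the increments of `M` on its two sides add up to the
    -- increment over the whole interval.
    rw [abs_of_nonpos (sub_nonpos.2 (hM htag.1))] at k1
    rw [abs_of_nonneg (sub_nonneg.2 (hM htag.2))] at k2
    rw [show (A (α (j + 1)) - A (α j)) (g (τ j)) - (F (α (j + 1)) - F (α j)) =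
      (F (α j) - F (τ j) - (A (α j) - A (τ j)) (g (τ j))) -
      (F (α (j + 1)) - F (τ j) - (A (α (j + 1)) - A (τ j)) (g (τ j))) by
        simp only [_root_.sub_apply]; abel]
    refine (_root_.norm_sub_le _ _).trans ((add_le_add k1 k2).trans (le_of_eq ?_))
    ring
  have hF : F b - F a = ∑ j ∈ Finset.range ν, (F (α (j + 1)) - F (α j)) := by
    rw [Finset.sum_range_sub (fun j => F (α j)), h1.1, h1.2.1]
  rw [hF, ← Finset.sum_sub_distrib]
  refine ((norm_sum_le _ _).trans (Finset.sum_le_sum hterm)).trans_lt ?_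
  rw [← Finset.mul_sum, Finset.sum_range_sub (fun j => M (α j)), h1.1, h1.2.1, hη,
    div_mul_eq_mul_div, div_lt_iff₀ (by positivity)]
  nlinarith

theorem IsPrimitive.hasKSIntegral (hM : Monotone M) (h : IsPrimitive M A g F Set.univ) (s t : ℝ) :
    HasKSIntegral A g s t (F t - F s) := by
  refine ⟨fun _ => (h.mono_set (Set.subset_univ _)).hasKSIntegralOn hM, fun _ => ?_⟩
  rw [neg_sub]
  exact (h.mono_set (Set.subset_univ _)).hasKSIntegralOn hM

end GLDE

/-! ### Regulated functions whose discontinuities sit at jumps of `M`. -/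

namespace GLDE

/-- `g` has a limit along the filter `l` of points near `τ`, which is `g τ` unless `M` jumps. -/
def RegAt {X : Type*} [TopologicalSpace X] (M : ℝ → ℝ) (l : Filter ℝ) (τ : ℝ) (g : ℝ → X) : Prop :=
  (∃ y, Tendsto g l (𝓝 y)) ∧ ((∃ c > 0, ∀ᶠ s in l, c ≤ |M s - M τ|) ∨ Tendsto g l (𝓝 (g τ)))

/-- `g` is regulated on `[a, b]` and has one-sided discontinuities only where `M` jumps. -/
def RegOn {X : Type*} [TopologicalSpace X] (M : ℝ → ℝ) (a b : ℝ) (g : ℝ → X) : Prop :=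
  (∀ τ ∈ Set.Ico a b, RegAt M (𝓝[>] τ) τ g) ∧ (∀ τ ∈ Set.Ioc a b, RegAt M (𝓝[<] τ) τ g)

section Regulated

variable {X : Type*} [NormedAddCommGroup X] {M : ℝ → ℝ} {l : Filter ℝ} {τ a b : ℝ} {g g' : ℝ → X}

theorem RegAt.add (h : RegAt M l τ g) (h' : RegAt M l τ g') :
    RegAt M l τ (fun t => g t + g' t) := by
  obtain ⟨⟨y, hy⟩, h2⟩ := h
  obtain ⟨⟨y', hy'⟩, h2'⟩ := h'
  refine ⟨⟨_, hy.add hy'⟩, ?_⟩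
  rcases h2 with h2 | h2
  · exact Or.inl h2
  rcases h2' with h2' | h2'
  · exact Or.inl h2'
  · exact Or.inr (h2.add h2')

theorem RegAt.const (y : X) : RegAt M l τ (fun _ => y) :=
  ⟨⟨y, tendsto_const_nhds⟩, Or.inr tendsto_const_nhds⟩

theorem RegOn.const (y : X) : RegOn M a b (fun _ => y) := ⟨fun _ _ => .const y, fun _ _ => .const y⟩

theorem RegOn.add (h : RegOn M a b g) (h' : RegOn M a b g') : RegOn M a b (fun t => g t + g' t) :=
  ⟨fun τ hτ => (h.1 τ hτ).add (h'.1 τ hτ), fun τ hτ => (h.2 τ hτ).add (h'.2 τ hτ)⟩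

theorem RegOn.mono {u v : ℝ} (h : RegOn M a b g) (hu : a ≤ u) (hv : v ≤ b) : RegOn M u v g :=
  ⟨fun τ hτ => h.1 τ ⟨hu.trans hτ.1, hτ.2.trans_le hv⟩,
    fun τ hτ => h.2 τ ⟨hu.trans_lt hτ.1, hτ.2.trans hv⟩⟩

theorem RegAt.reflect_left (h : RegAt M (𝓝[<] (-τ)) (-τ) g) :
    RegAt (fun t => -M (-t)) (𝓝[>] τ) τ (fun t => g (-t)) := by
  have ht : Tendsto (fun t : ℝ => -t) (𝓝[>] τ) (𝓝[<] (-τ)) := tendsto_neg_nhdsGT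
  obtain ⟨⟨y, hy⟩, h2⟩ := h
  refine ⟨⟨y, hy.comp ht⟩, h2.imp ?_ fun h => h.comp ht⟩
  rintro ⟨c, hc, H⟩
  refine ⟨c, hc, (ht.eventually H).mono fun s hs => ?_⟩
  rwa [show -M (-s) - -M (-τ) = -(M (-s) - M (-τ)) by ring, abs_neg]

theorem RegAt.reflect_right (h : RegAt M (𝓝[>] (-τ)) (-τ) g) :
    RegAt (fun t => -M (-t)) (𝓝[<] τ) τ (fun t => g (-t)) := by
  have ht : Tendsto (fun t : ℝ => -t) (𝓝[<] τ) (𝓝[>] (-τ)) := tendsto_neg_nhdsLT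
  obtain ⟨⟨y, hy⟩, h2⟩ := h
  refine ⟨⟨y, hy.comp ht⟩, h2.imp ?_ fun h => h.comp ht⟩
  rintro ⟨c, hc, H⟩
  refine ⟨c, hc, (ht.eventually H).mono fun s hs => ?_⟩
  rwa [show -M (-s) - -M (-τ) = -(M (-s) - M (-τ)) by ring, abs_neg]

theorem RegOn.reflect (h : RegOn M a b g) :
    RegOn (fun t => -M (-t)) (-b) (-a) (fun t => g (-t)) :=
  ⟨fun τ hτ => (h.2 (-τ) ⟨by linarith [hτ.2], by linarith [hτ.1]⟩).reflect_left,
    fun τ hτ => (h.1 (-τ) ⟨by linarith [hτ.2], by linarith [hτ.1]⟩).reflect_right⟩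

theorem monotone_reflect (hM : Monotone M) : Monotone (fun t => -M (-t)) :=
  fun _ _ h => neg_le_neg (hM (neg_le_neg h))

theorem IsDominated.reflect (h : IsDominated M g) :
    IsDominated (fun t => -M (-t)) (fun t => g (-t)) := by
  intro s t
  rw [show -M (-t) - -M (-s) = -(M (-t) - M (-s)) by ring, abs_neg]
  exact h _ _

/-- Domination transfers the Cauchy property from `M` to `g`, and continuity of `M` along `l` to
continuity of `g`. -/
theorem RegAt.of_isDominated [CompleteSpace X] [l.NeBot] (h : IsDominated M g) {m : ℝ}
    (hm : Tendsto M l (𝓝 m)) : RegAt M l τ g := by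
  constructor
  · rw [← cauchy_map_iff_exists_tendsto, cauchy_map_iff, tendsto_uniformity_iff_dist_tendsto_zero]
    refine ⟨‹_›, ?_⟩
    have := (cauchy_map_iff.1 hm.cauchy_map).2
    rw [tendsto_uniformity_iff_dist_tendsto_zero] at this
    refine squeeze_zero (fun _ => dist_nonneg) (fun p => ?_) this
    rw [dist_eq_norm, Real.dist_eq]
    exact h _ _
  · by_cases hmτ : m = M τ
    · right
      rw [tendsto_iff_norm_sub_tendsto_zero]
      have : Tendsto (fun s => |M s - M τ|) l (𝓝 |m - M τ|) := (hm.sub_const _).abs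
      rw [hmτ, sub_self, abs_zero] at this
      exact squeeze_zero (fun _ => norm_nonneg _) (fun s => h τ s) this
    · left
      have hpos : 0 < |m - M τ| := abs_pos.2 (sub_ne_zero.2 hmτ)
      refine ⟨|m - M τ| / 2, by positivity, ?_⟩
      have : Tendsto (fun s => |M s - M τ|) l (𝓝 |m - M τ|) := (hm.sub_const _).abs
      exact (this.eventually (lt_mem_nhds (half_lt_self hpos))).mono fun s hs => hs.le

theorem IsDominated.regOn [CompleteSpace X] (hM : Monotone M) (h : IsDominated M g) (a b : ℝ) :
    RegOn M a b g :=
  ⟨fun τ _ => .of_isDominated h (hM.tendsto_nhdsGT τ),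
    fun τ _ => .of_isDominated h (hM.tendsto_nhdsLT τ)⟩

theorem RegAt.of_approx [CompleteSpace X] [l.NeBot]
    (h : ∀ ε > 0, ∃ g', RegAt M l τ g' ∧ (∀ᶠ s in l, ‖g s - g' s‖ ≤ ε) ∧ ‖g τ - g' τ‖ ≤ ε) :
    RegAt M l τ g := by
  constructor
  · rw [← cauchy_map_iff_exists_tendsto, Metric.cauchy_iff]
    refine ⟨inferInstance, fun ε hε => ?_⟩
    obtain ⟨g', ⟨⟨y, hy⟩, -⟩, h2, -⟩ := h (ε / 5) (by positivity)
    refine ⟨Metric.ball y (ε / 2), ?_, fun p hp q hq => ?_⟩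
    · rw [mem_map]
      filter_upwards [h2, Metric.tendsto_nhds.1 hy (ε / 5) (by positivity)] with s h3 h4
      rw [← dist_eq_norm] at h3
      have := dist_triangle (g s) (g' s) y
      exact Metric.mem_ball.2 (by linarith)
    · have := dist_triangle_right p q y
      linarith [Metric.mem_ball.1 hp, Metric.mem_ball.1 hq]
  -- The jump alternative concerns `M` only; if it fails, all the approximants are continuous along
  -- `l`, and so is their uniform limit.
  · by_cases hJ : ∃ c > 0, ∀ᶠ s in l, c ≤ |M s - M τ|
    · exact Or.inl hJ
    refine Or.inr (Metric.tendsto_nhds.2 fun ε hε => ?_)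
    obtain ⟨g', ⟨-, h1⟩, h2, h5⟩ := h (ε / 5) (by positivity)
    filter_upwards [h2, Metric.tendsto_nhds.1 (h1.resolve_left hJ) (ε / 5) (by positivity)]
      with s h3 h4
    rw [← dist_eq_norm] at h3 h5
    rw [dist_comm] at h5
    linarith [dist_triangle4 (g s) (g' s) (g' τ) (g τ)]

theorem RegOn.of_approx [CompleteSpace X]
    (h : ∀ ε > 0, ∃ g', RegOn M a b g' ∧ ∀ t ∈ Set.Icc a b, ‖g t - g' t‖ ≤ ε) : RegOn M a b g := by
  refine ⟨fun τ hτ => .of_approx fun ε hε => ?_, fun τ hτ => .of_approx fun ε hε => ?_⟩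
  · obtain ⟨g', h1, h2⟩ := h ε hε
    exact ⟨g', h1.1 τ hτ, (eventually_of_mem self_mem_nhdsWithin h2).filter_mono
      (nhdsGT_le_nhdsWithin_Icc hτ), h2 τ ⟨hτ.1, hτ.2.le⟩⟩
  · obtain ⟨g', h1, h2⟩ := h ε hε
    exact ⟨g', h1.2 τ hτ, (eventually_of_mem self_mem_nhdsWithin h2).filter_mono
      (nhdsLT_le_nhdsWithin_Icc hτ), h2 τ ⟨hτ.1.le, hτ.2⟩⟩

theorem RegOn.exists_bound (h : RegOn M a b g) : ∃ D, ∀ t ∈ Set.Icc a b, ‖g t‖ ≤ D := by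
  rcases lt_or_ge a b with hab | hab
  swap
  · exact ⟨‖g a‖, fun t ht => by rw [le_antisymm (ht.2.trans hab) ht.1]⟩
  have key : ∀ {τ : ℝ} {l : Filter ℝ}, RegAt M l τ g → ∃ D, ‖g τ‖ ≤ D ∧ ∀ᶠ s in l, ‖g s‖ ≤ D := by
    rintro τ l ⟨⟨y, hy⟩, -⟩
    refine ⟨max ‖g τ‖ (‖y‖ + 1), le_max_left _ _, ?_⟩
    filter_upwards [hy.norm.eventually (gt_mem_nhds (lt_add_one ‖y‖))] with s hs
    exact hs.le.trans (le_max_right _ _)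
  refine cousin_induction (Q := fun u v => ∃ D, ∀ t ∈ Set.Icc u v, ‖g t‖ ≤ D) hab ?_ ?_ ?_
  · rintro u v w - - - - ⟨D, hD⟩ ⟨D', hD'⟩
    refine ⟨max D D', fun t ht => ?_⟩
    rcases le_total t v with h | h
    · exact (hD t ⟨ht.1, h⟩).trans (le_max_left _ _)
    · exact (hD' t ⟨h, ht.2⟩).trans (le_max_right _ _)
  · intro τ hτ
    obtain ⟨D, hD, H⟩ := key (h.1 τ hτ)
    obtain ⟨w, hw, H⟩ := mem_nhdsGT_iff_exists_Ioo_subset.1 H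
    filter_upwards [Ioo_mem_nhdsGT hw] with v hv
    refine ⟨D, fun t ht => ?_⟩
    rcases ht.1.eq_or_lt with rfl | h'
    · exact hD
    · exact H ⟨h', ht.2.trans_lt hv.2⟩
  · intro τ hτ
    obtain ⟨D, hD, H⟩ := key (h.2 τ hτ)
    obtain ⟨w, hw, H⟩ := mem_nhdsLT_iff_exists_Ioo_subset.1 H
    filter_upwards [Ioo_mem_nhdsLT hw] with v hv
    refine ⟨D, fun t ht => ?_⟩
    rcases ht.2.eq_or_lt with rfl | h'
    · exact hD
    · exact H ⟨hv.1.trans_le ht.1, h'⟩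

end Regulated

/-! ### Existence of primitives. -/

variable {E : Type*} [NormedAddCommGroup E] [NormedSpace ℝ E]
variable {M : ℝ → ℝ} {A : ℝ → E →L[ℝ] E} {g F : ℝ → E} {ε a b τ : ℝ} {l : Filter ℝ}

theorem tendsto_clm_apply {T : ℝ → E →L[ℝ] E} {L : E →L[ℝ] E} (h : Tendsto T l (𝓝 L)) (y : E) :
    Tendsto (fun s => T s y) l (𝓝 (L y)) :=
  ((ContinuousLinearMap.apply ℝ E y).continuous.tendsto L).comp h

theorem RegAt.of_residual (hA : RegAt M l τ A)
    (h : Tendsto (fun v => F v - F τ - (A v - A τ) (g τ)) l (𝓝 0)) : RegAt M l τ F := by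
  have key : ∀ L, Tendsto A l (𝓝 L) → Tendsto F l (𝓝 (F τ + (L - A τ) (g τ))) := by
    intro L hL
    have h1 : Tendsto (fun v => (A v - A τ) (g τ)) l (𝓝 ((L - A τ) (g τ))) :=
      tendsto_clm_apply (hL.sub_const (A τ)) _
    have := (h.add h1).const_add (F τ)
    rw [zero_add] at this
    exact this.congr fun v => by abel
  obtain ⟨⟨L, hL⟩, h2⟩ := hA
  refine ⟨⟨_, key L hL⟩, h2.imp_right fun h2 => ?_⟩
  simpa using key _ h2

/-- Since `M` has finite one-sided limits, an error `o(M v - M τ)` tends to 0 even where `M` jumps.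
-/
theorem IsPrimitive.tendsto_residual_right (hM : Monotone M)
    (h : IsPrimitive M A g F (Set.Icc a b)) (hτ : τ ∈ Set.Ico a b) :
    Tendsto (fun v => F v - F τ - (A v - A τ) (g τ)) (𝓝[>] τ) (𝓝 0) := by
  refine Metric.tendsto_nhds.2 fun ε hε => ?_
  set m := |sInf (M '' Set.Ioi τ) - M τ| with hm
  have hlim : Tendsto (fun s => |M s - M τ|) (𝓝[>] τ) (𝓝 m) :=
    ((hM.tendsto_nhdsGT τ).sub_const _).abs
  have hm0 : 0 ≤ m := abs_nonneg _
  filter_upwards [(h (ε / (m + 1)) (by positivity) τ ⟨hτ.1, hτ.2.le⟩).filter_mono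
    (nhdsGT_le_nhdsWithin_Icc hτ), hlim.eventually (gt_mem_nhds (lt_add_one m))] with v h1 h2
  rw [dist_zero_right]
  refine h1.trans_lt ?_
  calc ε / (m + 1) * |M v - M τ| < ε / (m + 1) * (m + 1) := by gcongr
    _ = ε := by field_simp

theorem IsPrimitive.tendsto_residual_left (hM : Monotone M)
    (h : IsPrimitive M A g F (Set.Icc a b)) (hτ : τ ∈ Set.Ioc a b) :
    Tendsto (fun v => F v - F τ - (A v - A τ) (g τ)) (𝓝[<] τ) (𝓝 0) := by
  have := (h.reflect.tendsto_residual_right (monotone_reflect hM)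
    (τ := -τ) ⟨by linarith [hτ.2], by linarith [hτ.1]⟩).comp tendsto_neg_nhdsLT
  simpa [Function.comp_def] using this

/-- One-sided local existence of approximate primitives. -/
theorem exists_isApproxPrimitive_of_regAt {I : Set ℝ} {y : E} (hA : IsDominated M A) (hε : 0 < ε)
    (hAr : RegAt M (𝓝[I \ {τ}] τ) τ A) (hg : RegAt M (𝓝[I \ {τ}] τ) τ g)
    (hy : Tendsto g (𝓝[I \ {τ}] τ) (𝓝 y)) (hyI : ∀ s ∈ I \ {τ}, ‖y - g s‖ ≤ ε) :
    ∃ F, IsApproxPrimitive ε M A g F I := by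
  obtain ⟨⟨L, hL⟩, -⟩ := hAr
  -- `F` integrates the function equal to `g τ` at `τ` and to `y` elsewhere, normalised to vanish at
  -- `τ`; `L` is the limit of `A` at `τ`.
  refine ⟨fun s => if s = τ then 0 else (L - A τ) (g τ) + (A s - L) y, fun σ hσ => ?_⟩
  rcases eq_or_ne σ τ with rfl | hne
  · have hle : 𝓝[I] σ ≤ pure σ ⊔ 𝓝[I \ {σ}] σ := by
      rw [← nhdsWithin_insert]
      exact nhdsWithin_mono _ fun s hs => by
        by_cases h : s = σ <;> simp [h, hs]
    refine Eventually.filter_mono hle (eventually_sup.2 ⟨by simp, ?_⟩)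
    have hres : ∀ s ≠ σ, (if s = σ then (0 : E) else (L - A σ) (g σ) + (A s - L) y) -
        (if σ = σ then (0 : E) else (L - A σ) (g σ) + (A σ - L) y) - (A s - A σ) (g σ) =
        (A s - L) (y - g σ) := by
      intro s hs
      simp only [if_neg hs, if_true, map_sub, _root_.sub_apply]
      abel
    -- At the base point the residual is (A(s) - L)(y - g(σ)), which tends to 0. A jump of `M`
    -- absorbs it; without a jump `y = g σ` and it vanishes.
    rcases hg.2 with ⟨c, hc, hJ⟩ | hcont
    · have hz : Tendsto (fun s => ‖(A s - L) (y - g σ)‖) (𝓝[I \ {σ}] σ) (𝓝 0) := by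
        have := (tendsto_clm_apply (hL.sub_const L) (y - g σ)).norm
        simpa using this
      filter_upwards [self_mem_nhdsWithin, hJ, hz.eventually (gt_mem_nhds (mul_pos hε hc))]
        with s h1 h2 h3
      rw [hres s h1.2]
      exact h3.le.trans (mul_le_mul_of_nonneg_left h2 hε.le)
    · rcases eq_or_neBot (𝓝[I \ {σ}] σ) with hb | hb
      · simp [hb]
      obtain rfl := tendsto_nhds_unique hy hcont
      filter_upwards [self_mem_nhdsWithin] with s h1
      rw [hres s h1.2, sub_self, map_zero, norm_zero]
      positivity
  · filter_upwards [mem_nhdsWithin_of_mem_nhds (isOpen_ne.mem_nhds hne)] with s hs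
    have : (if s = τ then (0 : E) else (L - A τ) (g τ) + (A s - L) y) -
        (if σ = τ then (0 : E) else (L - A τ) (g τ) + (A σ - L) y) - (A s - A σ) (g σ) =
        (A s - A σ) (y - g σ) := by
      simp only [if_neg hs, if_neg hne, map_sub, _root_.sub_apply]
      abel
    rw [this, mul_comm]
    exact ((A s - A σ).le_opNorm _).trans
      (mul_le_mul (hA σ s) (hyI σ ⟨hσ, hne⟩) (norm_nonneg _) (abs_nonneg _))

variable [CompleteSpace E]

theorem IsPrimitive.regOn (hM : Monotone M) (hA : IsDominated M A)
    (h : IsPrimitive M A g F (Set.Icc a b)) : RegOn M a b F :=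
  ⟨fun τ hτ => ((hA.regOn hM a b).1 τ hτ).of_residual (h.tendsto_residual_right hM hτ),
    fun τ hτ => ((hA.regOn hM a b).2 τ hτ).of_residual (h.tendsto_residual_left hM hτ)⟩

/-- One-sided limits make `g` nearly constant beside each point, so approximate primitives exist
locally; Cousin induction glues them after adding a constant. -/
theorem exists_isApproxPrimitive (hM : Monotone M) (hA : IsDominated M A) (hg : RegOn M a b g)
    (hab : a < b) (hε : 0 < ε) : ∃ F, IsApproxPrimitive ε M A g F (Set.Icc a b) := by
  have hmono : ∀ {X : Type _} [TopologicalSpace X] {l l' : Filter ℝ} {τ : ℝ} {h : ℝ → X}, l' ≤ l →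
      RegAt M l τ h → RegAt M l' τ h := by
    rintro X _ l l' τ h hl ⟨⟨y, hy⟩, h2⟩
    exact ⟨⟨y, hy.mono_left hl⟩, h2.imp (fun ⟨c, hc, H⟩ => ⟨c, hc, H.filter_mono hl⟩)
      fun h => h.mono_left hl⟩
  refine cousin_induction (Q := fun u v => ∃ F, IsApproxPrimitive ε M A g F (Set.Icc u v))
    hab ?_ ?_ ?_
  · rintro u v w - huv hvw - ⟨F, hF⟩ ⟨F', hF'⟩
    refine ⟨fun s => if s ≤ v then F s else F' s - F' v + F v, IsApproxPrimitive.glue (b := v) ?_ ?_⟩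
    · exact hF.congr (fun _ _ => rfl) fun s hs => by simp [hs.2]
    · have : IsApproxPrimitive ε M A g (fun s => F' s - F' v + F v) (Set.Icc v w) := by
        intro τ hτ
        filter_upwards [hF' τ hτ] with s hs
        simpa using hs
      refine this.congr (fun _ _ => rfl) fun s hs => ?_
      rcases hs.1.eq_or_lt with rfl | h
      · simp
      · simp [not_le.2 h]
  · intro τ hτ
    obtain ⟨y, hy⟩ := (hg.1 τ hτ).1
    obtain ⟨w, hw, H⟩ := mem_nhdsGT_iff_exists_Ioo_subset.1 (Metric.tendsto_nhds.1 hy ε hε)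
    filter_upwards [Ioo_mem_nhdsGT hw] with v hv
    have hle : 𝓝[Set.Icc τ v \ {τ}] τ ≤ 𝓝[>] τ :=
      nhdsWithin_mono _ fun s hs => lt_of_le_of_ne hs.1.1 (Ne.symm hs.2)
    refine exists_isApproxPrimitive_of_regAt hA hε (hmono hle ((hA.regOn hM a b).1 τ hτ))
      (hmono hle (hg.1 τ hτ)) (hy.mono_left hle) fun s hs => ?_
    rw [norm_sub_rev, ← dist_eq_norm]
    exact (H ⟨lt_of_le_of_ne hs.1.1 (Ne.symm hs.2), hs.1.2.trans_lt hv.2⟩ : dist (g s) y < ε).le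
  · intro τ hτ
    obtain ⟨y, hy⟩ := (hg.2 τ hτ).1
    obtain ⟨w, hw, H⟩ := mem_nhdsLT_iff_exists_Ioo_subset.1 (Metric.tendsto_nhds.1 hy ε hε)
    filter_upwards [Ioo_mem_nhdsLT hw] with v hv
    have hle : 𝓝[Set.Icc v τ \ {τ}] τ ≤ 𝓝[<] τ :=
      nhdsWithin_mono _ fun s hs => lt_of_le_of_ne hs.1.2 hs.2
    refine exists_isApproxPrimitive_of_regAt hA hε (hmono hle ((hA.regOn hM a b).2 τ hτ))
      (hmono hle (hg.2 τ hτ)) (hy.mono_left hle) fun s hs => ?_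
    rw [norm_sub_rev, ← dist_eq_norm]
    exact (H ⟨hv.1.trans_le hs.1.1, lt_of_le_of_ne hs.1.2 hs.2⟩ : dist (g s) y < ε).le

/-- Regulated functions have primitives. -/
theorem exists_isPrimitive (hM : Monotone M) (hA : IsDominated M A) (hg : RegOn M a b g)
    (hab : a < b) : ∃ F, IsPrimitive M A g F (Set.Icc a b) := by
  set e : ℕ → ℝ := fun k => 1 / ((k : ℝ) + 1) with he
  have he0 : ∀ k, 0 < e k := fun k => by positivity
  have hlim : Tendsto e atTop (𝓝 0) := tendsto_one_div_add_atTop_nhds_zero_nat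
  choose G hG using fun k => exists_isApproxPrimitive hM hA hg hab (he0 k)
  have ha : a ∈ Set.Icc a b := ⟨le_rfl, hab.le⟩
  have hanti : ∀ {n N : ℕ}, N ≤ n → e n ≤ e N := fun h => by simp only [he]; gcongr
  have hex : ∀ t, ∃ y, t ∈ Set.Icc a b → Tendsto (fun k => G k t - G k a) atTop (𝓝 y) := by
    intro t
    by_cases ht : t ∈ Set.Icc a b
    · have : CauchySeq (fun k => G k t - G k a) := by
        refine cauchySeq_of_le_tendsto_0 (fun N => (e N + e N) * |M t - M a|) ?_ ?_
        · intro n m N hn hm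
          rw [dist_eq_norm, show G n t - G n a - (G m t - G m a) =
            (G n t - G m t) - (G n a - G m a) by abel]
          refine ((hG n).norm_sub_sub_le hM (hG m) ha ht).trans ?_
          exact mul_le_mul_of_nonneg_right (add_le_add (hanti hn) (hanti hm)) (abs_nonneg _)
        · simpa using (hlim.add hlim).mul_const |M t - M a|
      obtain ⟨y, hy⟩ := cauchySeq_tendsto_of_complete this
      exact ⟨y, fun _ => hy⟩
    · exact ⟨0, fun h => absurd h ht⟩
  choose F hF using hex
  -- Letting n → ∞ in the estimate for `G n - G k` bounds the slope of `F - G k` by `e k`, so `F`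
  -- inherits the local estimates of the `G k`.
  have hdiff : ∀ k, ∀ s ∈ Set.Icc a b, ∀ t ∈ Set.Icc a b,
      ‖(F t - F s) - (G k t - G k s)‖ ≤ e k * |M t - M s| := by
    intro k s hs t ht
    have h1 : Tendsto (fun n => ‖(G n t - G n a - (G n s - G n a)) - (G k t - G k s)‖) atTop
        (𝓝 ‖(F t - F s) - (G k t - G k s)‖) := (((hF t ht).sub (hF s hs)).sub_const _).norm
    have h2 : Tendsto (fun n => (e n + e k) * |M t - M s|) atTop (𝓝 ((0 + e k) * |M t - M s|)) :=
      (hlim.add_const _).mul_const _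
    rw [zero_add] at h2
    refine le_of_tendsto_of_tendsto' h1 h2 fun n => ?_
    rw [show (G n t - G n a - (G n s - G n a)) - (G k t - G k s) =
      (G n t - G k t) - (G n s - G k s) by abel]
    exact (hG n).norm_sub_sub_le hM (hG k) hs ht
  refine ⟨F, fun ε hε τ hτ => ?_⟩
  obtain ⟨k, hk⟩ := (hlim.eventually (gt_mem_nhds (half_pos hε))).exists
  filter_upwards [hG k τ hτ, self_mem_nhdsWithin] with v h1 hv
  have h2 := hdiff k τ hτ v hv
  rw [show F v - F τ - (A v - A τ) (g τ) = ((F v - F τ) - (G k v - G k τ)) +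
    (G k v - G k τ - (A v - A τ) (g τ)) by abel]
  refine (norm_add_le _ _).trans ((add_le_add h2 h1).trans ?_)
  rw [← add_mul]
  exact mul_le_mul_of_nonneg_right (by linarith) (abs_nonneg _)

end GLDE

/-! ### Contraction and local existence. -/

namespace GLDE

/-- Banach's iteration on functions compared in the uniform norm on `S`. The class `P` is only
required to be closed under uniform approximation on `S`, so no space of regulated functions has to
be built. -/
theorem exists_fixedPoint {E : Type*} [NormedAddCommGroup E] [CompleteSpace E] {P : (ℝ → E) → Prop} {S : Set ℝ}
    (T : (ℝ → E) → ℝ → E) (hT : ∀ x, P x → P (T x))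
    (hc : ∀ x x' D, P x → P x' → (∀ t ∈ S, ‖x t - x' t‖ ≤ D) → ∀ t ∈ S, ‖T x t - T x' t‖ ≤ D / 2)
    (hlim : ∀ x, (∀ ε > 0, ∃ x', P x' ∧ ∀ t ∈ S, ‖x t - x' t‖ ≤ ε) → P x)
    {x₀ : ℝ → E} (h₀ : P x₀) {D : ℝ} (hD : ∀ t ∈ S, ‖x₀ t - T x₀ t‖ ≤ D) :
    ∃ x, P x ∧ ∀ t ∈ S, T x t = x t := by
  set X : ℕ → ℝ → E := fun k => T^[k] x₀ with hX
  have hsucc : ∀ k, X (k + 1) = T (X k) := fun k => Function.iterate_succ_apply' T k x₀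
  have hP : ∀ k, P (X k) := by
    intro k
    induction k with
    | zero => exact h₀
    | succ k ih => rw [hsucc]; exact hT _ ih
  have hstep : ∀ k, ∀ t ∈ S, ‖X k t - X (k + 1) t‖ ≤ D / 2 ^ k := by
    intro k
    induction k with
    | zero => simpa [hX] using hD
    | succ k ih =>
      intro t ht
      have := hc _ _ _ (hP k) (hP (k + 1)) ih t ht
      rwa [← hsucc, ← hsucc, div_div, ← pow_succ] at this
  have hdist : ∀ t ∈ S, ∀ k, dist (X k t) (X (k + 1) t) ≤ 2 * D / 2 / 2 ^ k := by
    intro t ht k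
    rw [dist_eq_norm, mul_div_cancel_left₀ _ (two_ne_zero' ℝ)]
    exact hstep k t ht
  have hex : ∀ t, ∃ y, t ∈ S → Tendsto (fun k => X k t) atTop (𝓝 y) := by
    intro t
    by_cases ht : t ∈ S
    · obtain ⟨y, hy⟩ := cauchySeq_tendsto_of_complete (cauchySeq_of_le_geometric_two (hdist t ht))
      exact ⟨y, fun _ => hy⟩
    · exact ⟨0, fun h => absurd h ht⟩
  choose x hx using hex
  have hbound : ∀ k, ∀ t ∈ S, ‖x t - X k t‖ ≤ 2 * D / 2 ^ k := by
    intro k t ht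
    rw [norm_sub_rev, ← dist_eq_norm]
    exact dist_le_of_le_geometric_two_of_tendsto (hdist t ht) (hx t ht) k
  have hto : Tendsto (fun k : ℕ => 2 * D / 2 ^ k) atTop (𝓝 0) :=
    tendsto_const_nhds.div_atTop (tendsto_pow_atTop_atTop_of_one_lt one_lt_two)
  have hPx : P x := by
    refine hlim x fun ε hε => ?_
    obtain ⟨k, hk⟩ := (hto.eventually (gt_mem_nhds hε)).exists
    exact ⟨X k, hP k, fun t ht => (hbound k t ht).trans hk.le⟩
  refine ⟨x, hPx, fun t ht => ?_⟩
  refine tendsto_nhds_unique ?_ ((tendsto_add_atTop_iff_nat 1).2 (hx t ht))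
  rw [tendsto_iff_norm_sub_tendsto_zero]
  refine squeeze_zero (fun _ => norm_nonneg _) (fun k => ?_) (by simpa using hto.div_const 2)
  rw [norm_sub_rev, hsucc]
  exact hc _ _ _ hPx (hP k) (hbound k) t ht

variable {E : Type*} [NormedAddCommGroup E] [NormedSpace ℝ E]
variable {M : ℝ → ℝ} {A : ℝ → E →L[ℝ] E} {f g x F : ℝ → E} {a b c τ : ℝ}

/-- Invertibility of the jump factors of `A`, in terms of limits. -/
def JumpsInvertible (A : ℝ → E →L[ℝ] E) : Prop :=
  ∀ τ L, (Tendsto A (𝓝[<] τ) (𝓝 L) → IsUnit (1 - (A τ - L))) ∧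
    (Tendsto A (𝓝[>] τ) (𝓝 L) → IsUnit (1 + (L - A τ)))

theorem ConditionH.jumpsInvertible (h : ConditionH A) : JumpsInvertible A := by
  refine fun τ L => ⟨fun hL => ?_, fun hL => ?_⟩
  · rw [← leftLim_eq_of_tendsto hL]; exact (h τ).1
  · rw [← rightLim_eq_of_tendsto hL]; exact (h τ).2

theorem JumpsInvertible.reflect (h : JumpsInvertible A) : JumpsInvertible (fun t => A (-t)) := by
  refine fun τ L => ⟨fun hL => ?_, fun hL => ?_⟩
  · have := (h (-τ) L).2 (by simpa [Function.comp_def] using hL.comp tendsto_neg_nhdsGT_neg)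
    rwa [show (1 : E →L[ℝ] E) - (A (-τ) - L) = 1 + (L - A (-τ)) by abel]
  · have := (h (-τ) L).1 (by simpa [Function.comp_def] using hL.comp tendsto_neg_nhdsLT_neg)
    rwa [show (1 : E →L[ℝ] E) + (L - A (-τ)) = 1 - (A (-τ) - L) by abel]

/-- `M` varies by at most `1/2` on `(a, b]`. -/
def IsShort (M : ℝ → ℝ) (a b : ℝ) : Prop := ∀ u v, a < u → u ≤ v → v ≤ b → M v - M u ≤ 1 / 2

theorem eventually_isShort (hM : Monotone M) (τ : ℝ) : ∀ᶠ v in 𝓝[>] τ, IsShort M τ v := by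
  have h := hM.tendsto_nhdsGT τ
  filter_upwards [h.eventually (gt_mem_nhds (lt_add_of_pos_right _ (half_pos one_pos)))]
    with v hv u w hu _ hw
  have h1 : sInf (M '' Set.Ioi τ) ≤ M u :=
    csInf_le ⟨M τ, by rintro _ ⟨s, hs, rfl⟩; exact hM (le_of_lt hs)⟩ ⟨u, hu, rfl⟩
  linarith [hM hw]

/-- Because `g a = 0`, `F` is right-continuous at `a`. A jump of `M` at `a` therefore costs nothing,
and only the variation of `M` on (a, b] counts. -/
theorem IsPrimitive.norm_sub_le_half (hM : Monotone M) (hA : IsDominated M A)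
    (h : IsPrimitive M A g F (Set.Icc a b)) (hs : IsShort M a b) (hga : g a = 0) {D : ℝ}
    (hg : ∀ t ∈ Set.Icc a b, ‖g t‖ ≤ D) {t : ℝ} (ht : t ∈ Set.Icc a b) :
    ‖F t - F a‖ ≤ D / 2 := by
  have hD : 0 ≤ D := (norm_nonneg _).trans (hg t ht)
  rcases ht.1.eq_or_lt with rfl | hat
  · simpa using div_nonneg hD zero_le_two
  have h0 : Tendsto F (𝓝[>] a) (𝓝 (F a)) := by
    have := (h.tendsto_residual_right hM (τ := a) ⟨le_rfl, hat.trans_le ht.2⟩).add_const (F a)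
    simpa [hga] using this
  refine le_of_tendsto ((h0.const_sub (F t)).norm) ?_
  filter_upwards [Ioo_mem_nhdsGT hat] with u hu
  refine (h.norm_sub_le hM hA hg ⟨hu.1.le, hu.2.le.trans ht.2⟩ ht).trans ?_
  rw [abs_of_nonneg (sub_nonneg.2 (hM hu.2.le))]
  have := hs u t hu.1 hu.2.le ht.2
  nlinarith

theorem exists_solution_of_isShort [CompleteSpace E] (hM : Monotone M) (hA : IsDominated M A)
    (hf : RegOn M a b f) (hab : a < b) (hs : IsShort M a b) (y : E) :
    ∃ x : ℝ → E, x a = y ∧ IsPrimitive M A x (fun t => x t - f t) (Set.Icc a b) := by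
  have hex : ∀ x : ℝ → E, ∃ F, RegOn M a b x → IsPrimitive M A x F (Set.Icc a b) := by
    intro x
    by_cases hx : RegOn M a b x
    · obtain ⟨F, hF⟩ := exists_isPrimitive hM hA hx hab
      exact ⟨F, fun _ => hF⟩
    · exact ⟨0, fun h => absurd h hx⟩
  choose I hI using hex
  -- The constant forces `T x a = y`, so differences of admissible functions vanish at `a`, as the
  -- contraction estimate requires.
  set T : (ℝ → E) → ℝ → E := fun x t => (I x t + f t) + (y - I x a - f a) with hTdef
  have hT : ∀ x, (RegOn M a b x ∧ x a = y) → (RegOn M a b (T x) ∧ T x a = y) := by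
    rintro x ⟨hx, -⟩
    refine ⟨(((hI x hx).regOn hM hA).add hf).add (.const _), ?_⟩
    simp only [hTdef]; abel
  obtain ⟨D, hD⟩ := ((hT (fun _ => y) ⟨.const y, rfl⟩).1).exists_bound
  have hc : ∀ x x' D, (RegOn M a b x ∧ x a = y) → (RegOn M a b x' ∧ x' a = y) →
      (∀ t ∈ Set.Icc a b, ‖x t - x' t‖ ≤ D) → ∀ t ∈ Set.Icc a b, ‖T x t - T x' t‖ ≤ D / 2 := by
    rintro x x' D ⟨hx, hxa⟩ ⟨hx', hxa'⟩ hD t ht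
    have := ((hI x hx).sub (hI x' hx')).norm_sub_le_half hM hA hs (by simp [hxa, hxa']) hD ht
    rw [show T x t - T x' t = (I x t - I x' t) - (I x a - I x' a) by simp only [hTdef]; abel]
    exact this
  have hlim : ∀ x, (∀ ε > 0, ∃ x', (RegOn M a b x' ∧ x' a = y) ∧
      ∀ t ∈ Set.Icc a b, ‖x t - x' t‖ ≤ ε) → RegOn M a b x ∧ x a = y := by
    intro x h
    refine ⟨.of_approx fun ε hε => ?_, eq_of_forall_dist_le fun ε hε => ?_⟩
    · obtain ⟨x', hx', h'⟩ := h ε hε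
      exact ⟨x', hx'.1, h'⟩
    · obtain ⟨x', hx', h'⟩ := h ε hε
      rw [dist_eq_norm, ← hx'.2]
      exact h' a ⟨le_rfl, hab.le⟩
  obtain ⟨x, ⟨hx, hxa⟩, hfix⟩ := exists_fixedPoint (P := fun x => RegOn M a b x ∧ x a = y)
    T hT hc hlim (x₀ := fun _ => y) ⟨.const y, rfl⟩ (D := ‖y‖ + D)
    fun t ht => (norm_sub_le _ _).trans (add_le_add le_rfl (hD t ht))
  refine ⟨x, hxa, ((hI x hx).add_const (y - I x a - f a)).congr (fun _ _ => rfl) fun t ht => ?_⟩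
  have := hfix t ht
  simp only [hTdef] at this
  show I x t + (y - I x a - f a) = x t - f t
  rw [eq_sub_iff_add_eq, ← this]
  abel

/-! ### Uniqueness, from invertibility at the jumps. -/

section Uniqueness

/-- If `x τ = 0`, the halving estimate iterates to `x = 0` just to the right. If `x τ ≠ 0`, the
right limit (1 + Δ⁺A(τ))x(τ) is nonzero by (H). The equivalence form is transitive and symmetric,
which suits Cousin induction and reflection. -/
theorem eventually_eq_zero_iff_right [CompleteSpace E] (hM : Monotone M) (hA : IsDominated M A)
    (hH : JumpsInvertible A) (h : IsPrimitive M A x x (Set.Icc a b)) (hτ : τ ∈ Set.Ico a b) :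
    ∀ᶠ v in 𝓝[>] τ, (x τ = 0 ↔ x v = 0) := by
  obtain ⟨L, hL⟩ := ((hA.regOn hM a b).1 τ hτ).1
  have hlim : Tendsto x (𝓝[>] τ) (𝓝 ((1 + (L - A τ)) (x τ))) := by
    have := ((h.tendsto_residual_right hM hτ).add
      (tendsto_clm_apply (hL.sub_const (A τ)) (x τ))).const_add (x τ)
    rw [zero_add] at this
    exact this.congr fun v => by abel
  by_cases h0 : x τ = 0
  · rw [h0, map_zero] at hlim
    have hex : ∀ᶠ v in 𝓝[>] τ, ∀ t ∈ Set.Icc τ v, ‖x t‖ ≤ 1 := by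
      obtain ⟨w, hw, H⟩ := mem_nhdsGT_iff_exists_Ioo_subset.1
        (Metric.tendsto_nhds.1 hlim 1 one_pos)
      filter_upwards [Ioo_mem_nhdsGT hw] with v hv t ht
      rcases ht.1.eq_or_lt with rfl | h'
      · simp [h0]
      · have : dist (x t) 0 < 1 := H ⟨h', ht.2.trans_lt hv.2⟩
        rw [dist_zero_right] at this
        exact this.le
    filter_upwards [hex, eventually_isShort hM τ, Ioo_mem_nhdsGT hτ.2] with v h1 h2 hv
    have hsub : Set.Icc τ v ⊆ Set.Icc a b := Set.Icc_subset_Icc hτ.1 hv.2.le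
    have hpow : ∀ k : ℕ, ∀ t ∈ Set.Icc τ v, ‖x t‖ ≤ 1 / 2 ^ k := by
      intro k
      induction k with
      | zero => simpa using h1
      | succ k ih =>
        intro t ht
        have := (h.mono_set hsub).norm_sub_le_half hM hA h2 h0 ih ht
        rwa [h0, sub_zero, div_div, ← pow_succ] at this
    refine iff_of_true h0 (norm_le_zero_iff.1 ?_)
    have hto : Tendsto (fun k : ℕ => (1 : ℝ) / 2 ^ k) atTop (𝓝 0) :=
      tendsto_const_nhds.div_atTop (tendsto_pow_atTop_atTop_of_one_lt one_lt_two)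
    exact ge_of_tendsto' hto fun k => hpow k v ⟨hv.1.le, le_rfl⟩
  · have hne : (1 + (L - A τ)) (x τ) ≠ 0 := by
      intro h1
      have hinj := (ContinuousLinearMap.isUnit_iff_bijective.1 ((hH τ L).2 hL)).injective
      exact h0 (hinj (h1.trans (map_zero _).symm))
    filter_upwards [hlim.eventually (isOpen_ne.mem_nhds hne)] with v hv
    exact iff_of_false h0 hv

theorem eq_zero_iff_eq_zero_of_lt [CompleteSpace E] (hM : Monotone M) (hA : IsDominated M A)
    (hH : JumpsInvertible A) (h : IsPrimitive M A x x (Set.Icc a b)) (hab : a < b) :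
    x a = 0 ↔ x b = 0 := by
  refine cousin_induction (Q := fun u v => (x u = 0 ↔ x v = 0)) hab ?_ ?_ ?_
  · intro u v w _ _ _ _ h1 h2
    exact h1.trans h2
  · exact fun τ hτ => eventually_eq_zero_iff_right hM hA hH h hτ
  · intro τ hτ
    have := (tendsto_neg_nhdsLT (a := τ)).eventually
      (eventually_eq_zero_iff_right (monotone_reflect hM) hA.reflect hH.reflect h.reflect
        (τ := -τ) ⟨by linarith [hτ.2], by linarith [hτ.1]⟩)
    simp only [neg_neg] at this
    exact this.mono fun u hu => hu.symm

theorem eq_zero_iff_eq_zero [CompleteSpace E] (hM : Monotone M) (hA : IsDominated M A)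
    (hH : JumpsInvertible A) (h : IsPrimitive M A x x (Set.Icc a b)) {s t : ℝ}
    (hs : s ∈ Set.Icc a b) (ht : t ∈ Set.Icc a b) : x s = 0 ↔ x t = 0 := by
  rcases lt_trichotomy s t with hst | rfl | hst
  · exact eq_zero_iff_eq_zero_of_lt hM hA hH
      (h.mono_set (Set.Icc_subset_Icc hs.1 ht.2)) hst
  · rfl
  · exact (eq_zero_iff_eq_zero_of_lt hM hA hH
      (h.mono_set (Set.Icc_subset_Icc ht.1 hs.2)) hst).symm

theorem eqOn_of_eq [CompleteSpace E] (hM : Monotone M) (hA : IsDominated M A)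
    (hH : JumpsInvertible A) {x' : ℝ → E}
    (h : IsPrimitive M A x (fun t => x t - f t) (Set.Icc a b))
    (h' : IsPrimitive M A x' (fun t => x' t - f t) (Set.Icc a b)) (hc : c ∈ Set.Icc a b)
    (hcc : x c = x' c) : Set.EqOn x x' (Set.Icc a b) := by
  intro t ht
  have hd : IsPrimitive M A (fun t => x t - x' t) (fun t => x t - x' t) (Set.Icc a b) := by
    simpa using h.sub h'
  exact sub_eq_zero.1 ((eq_zero_iff_eq_zero hM hA hH hd hc ht).1 (sub_eq_zero.2 hcc))

end Uniqueness

/-! ### Existence from any base point in finite dimension. -/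

theorem IsPrimitive.sum {ι : Type*} (s : Finset ι) {S : Set ℝ} {g F : ι → ℝ → E}
    (h : ∀ i ∈ s, IsPrimitive M A (g i) (F i) S) :
    IsPrimitive M A (fun t => ∑ i ∈ s, g i t) (fun t => ∑ i ∈ s, F i t) S := by
  classical
  induction s using Finset.induction_on with
  | empty =>
    intro ε hε τ _
    refine Eventually.of_forall fun v => ?_
    simp only [Finset.sum_empty, sub_self, map_zero, norm_zero]
    positivity
  | insert i s hi ih =>
    simp only [Finset.sum_insert hi]
    exact (h i (Finset.mem_insert_self i s)).add
      (ih fun j hj => h j (Finset.mem_insert_of_mem hj))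

variable [FiniteDimensional ℝ E]

/-- Solvability of the homogeneous initial value problem at one point gives solvability of the
inhomogeneous problem at any other point. -/
theorem exists_solution_of_exists (hM : Monotone M) (hA : IsDominated M A)
    (hH : JumpsInvertible A) {p q : ℝ} (hp : p ∈ Set.Icc a b) (hq : q ∈ Set.Icc a b)
    (h₀ : ∀ y, ∃ x : ℝ → E, x p = y ∧ IsPrimitive M A x x (Set.Icc a b))
    (hx : IsPrimitive M A x (fun t => x t - f t) (Set.Icc a b)) (y : E) :
    ∃ x : ℝ → E, x q = y ∧ IsPrimitive M A x (fun t => x t - f t) (Set.Icc a b) := by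
  have : CompleteSpace E := FiniteDimensional.complete ℝ E
  choose X hXp hX using h₀
  let B := Module.finBasis ℝ E
  set φ : E → ℝ → E := fun z t => ∑ i, B.equivFun z i • X (B i) t with hφ
  have hφP : ∀ z, IsPrimitive M A (φ z) (φ z) (Set.Icc a b) := fun z =>
    IsPrimitive.sum Finset.univ fun i _ => (hX (B i)).smul _
  have hφp : ∀ z, φ z p = z := fun z => by
    simp only [hφ, hXp]
    exact B.sum_equivFun z
  -- The map sends a value at `p` to the value at `q` of its homogeneous solution. It is injective
  -- because solutions vanishing at `q` vanish at `p`; surjectivity then provides the correction of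
  -- `x q` to `y`.
  have hinj : Function.Injective (B.constr ℝ fun i => X (B i) q) := by
    rw [injective_iff_map_eq_zero]
    intro z hz
    rw [Module.Basis.constr_apply_fintype] at hz
    rw [← hφp z]
    exact (eq_zero_iff_eq_zero hM hA hH (hφP z) hq hp).1 hz
  obtain ⟨z, hz⟩ := LinearMap.injective_iff_surjective.1 hinj (y - x q)
  rw [Module.Basis.constr_apply_fintype] at hz
  refine ⟨fun t => x t + φ z t, ?_, ?_⟩
  · show x q + φ z q = y
    rw [show φ z q = y - x q from hz]; abel
  · refine (hx.add (hφP z)).congr (fun _ _ => rfl) fun t _ => ?_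
    simp only; abel

theorem exists_solution_Icc (hM : Monotone M) (hA : IsDominated M A) (hH : JumpsInvertible A)
    (hf : RegOn M a b f) (hab : a < b) (hc : c ∈ Set.Icc a b) (y : E) :
    ∃ x : ℝ → E, x c = y ∧ IsPrimitive M A x (fun t => x t - f t) (Set.Icc a b) := by
  have : CompleteSpace E := FiniteDimensional.complete ℝ E
  have main : ∀ f : ℝ → E, RegOn M a b f → ∀ y, ∃ x : ℝ → E, x a = y ∧
      IsPrimitive M A x (fun t => x t - f t) (Set.Icc a b) := by
    intro f hf
    refine cousin_induction (Q := fun u v => ∀ y, ∃ x : ℝ → E, x u = y ∧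
      IsPrimitive M A x (fun t => x t - f t) (Set.Icc u v)) hab ?_ ?_ ?_
    · intro u v w _ huv hvw _ h1 h2 y
      obtain ⟨x, hxu, hx⟩ := h1 y
      obtain ⟨x', hxv, hx'⟩ := h2 (x v)
      set z : ℝ → E := fun s => if s ≤ v then x s else x' s with hz
      have e1 : Set.EqOn x z (Set.Icc u v) := fun s hs => by simp [hz, hs.2]
      have e2 : Set.EqOn x' z (Set.Icc v w) := fun s hs => by
        rcases hs.1.eq_or_lt with rfl | h
        · simp [hz, hxv]
        · simp [hz, not_le.2 h]
      refine ⟨z, by simp [hz, huv.le, hxu], IsPrimitive.glue (b := v) ?_ ?_⟩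
      · exact hx.congr e1 fun s hs => by simp only [e1 hs]
      · exact hx'.congr e2 fun s hs => by simp only [e2 hs]
    · intro τ hτ
      filter_upwards [eventually_isShort hM τ, Ioo_mem_nhdsGT hτ.2] with v hv hvb y
      exact exists_solution_of_isShort hM hA (hf.mono hτ.1 hvb.2.le) hvb.1 hv y
    · intro τ hτ
      -- To the left of `τ` the contraction runs backwards and prescribes values at `τ`;
      -- `exists_solution_of_exists` converts this into prescribed values at `u`.
      filter_upwards [tendsto_neg_nhdsLT.eventually
        (eventually_isShort (monotone_reflect hM) (-τ)), Ioo_mem_nhdsLT hτ.1] with u hu hua y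
      have key : ∀ f : ℝ → E, RegOn M a b f → ∀ y, ∃ x : ℝ → E, x τ = y ∧
          IsPrimitive M A x (fun t => x t - f t) (Set.Icc u τ) := by
        intro f hf y
        obtain ⟨x, hx, hP⟩ := exists_solution_of_isShort (monotone_reflect hM) hA.reflect
          (hf.mono hua.1.le hτ.2).reflect (neg_lt_neg hua.2) hu y
        refine ⟨fun t => x (-t), hx, ?_⟩
        have := hP.reflect
        simpa using this
      obtain ⟨xp, -, hxp⟩ := key f hf 0
      refine exists_solution_of_exists hM hA hH (p := τ) ⟨hua.2.le, le_rfl⟩ ⟨le_rfl, hua.2.le⟩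
        (fun y => ?_) hxp y
      simpa using key (fun _ => 0) (.const 0) y
  obtain ⟨xp, -, hxp⟩ := main f hf 0
  refine exists_solution_of_exists hM hA hH (p := a) ⟨le_rfl, hab.le⟩ hc (fun y => ?_) hxp y
  simpa using main (fun _ => 0) (.const 0) y

/-- Global existence for the initial value problem. -/
theorem exists_solution (hM : Monotone M) (hA : IsDominated M A) (hH : JumpsInvertible A)
    (hf : ∀ a b, RegOn M a b f) (c : ℝ) (y : E) :
    ∃ x : ℝ → E, x c = y ∧ IsPrimitive M A x (fun t => x t - f t) Set.univ := by
  have : CompleteSpace E := FiniteDimensional.complete ℝ E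
  have hex : ∀ n : ℕ, ∃ x : ℝ → E, x c = y ∧
      IsPrimitive M A x (fun t => x t - f t) (Set.Icc (c - (n + 1)) (c + (n + 1))) := fun n =>
    have hn : (0 : ℝ) < n + 1 := by positivity
    exists_solution_Icc hM hA hH (hf _ _) (by linarith) ⟨by linarith, by linarith⟩ y
  choose X hXc hX using hex
  have hagree : ∀ {m n : ℕ}, m ≤ n → ∀ t, |t - c| ≤ m + 1 → X m t = X n t := by
    intro m n hmn t ht
    have hmn' : (m : ℝ) ≤ n := by exact_mod_cast hmn
    have hm : (0 : ℝ) < m + 1 := by positivity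
    obtain ⟨h1, h2⟩ := abs_le.1 ht
    refine eqOn_of_eq hM hA hH (hX m) ((hX n).mono_set
      (Set.Icc_subset_Icc (by linarith) (by linarith))) (c := c) ⟨by linarith, by linarith⟩
      ((hXc m).trans (hXc n).symm) ⟨by linarith, by linarith⟩
  -- Any index whose interval contains `t` gives the same value, by uniqueness.
  set x : ℝ → E := fun t => X ⌈|t - c|⌉₊ t with hx
  have hxX : ∀ (n : ℕ) t, |t - c| ≤ n → X n t = x t := by
    intro n t ht
    have h1 : ⌈|t - c|⌉₊ ≤ n := Nat.ceil_le.2 ht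
    exact (hagree h1 t ((Nat.le_ceil _).trans (by linarith))).symm
  refine ⟨x, by simp [hx, hXc], IsPrimitive.univ fun a b => ?_⟩
  obtain ⟨n, hn⟩ := exists_nat_ge (max |a - c| |b - c|)
  have hab : ∀ t ∈ Set.Icc a b, |t - c| ≤ n := by
    intro t ht
    have h1 := abs_le.1 ((le_max_left _ _).trans hn)
    have h2 := abs_le.1 ((le_max_right _ _).trans hn)
    exact abs_le.2 ⟨by linarith [ht.1], by linarith [ht.2]⟩
  have hsub : Set.Icc a b ⊆ Set.Icc (c - ((n : ℝ) + 1)) (c + (n + 1)) := fun t ht => by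
    have := abs_le.1 (hab t ht)
    exact ⟨by linarith, by linarith⟩
  refine ((hX n).mono_set hsub).congr (fun t ht => hxX n t (hab t ht)) fun t ht => ?_
  simp only [hxX n t (hab t ht)]

end GLDE

/-! ### Construction of the majorant `M`. -/

namespace GLDE

section Majorant

variable {X : Type*} [NormedAddCommGroup X]

/-- Beside any point `τ`, one-sided limits force small oscillation, so on a short one-sided interval
only `τ` itself can be exceptional. -/
theorem IsRegulated.finite_setOf_oscillation {f : ℝ → X} (hf : IsRegulated f) {ε : ℝ} (hε : 0 < ε)
    {a b : ℝ} (hab : a < b) :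
    ({t | ¬ ∀ᶠ s in 𝓝 t, ‖f s - f t‖ ≤ ε} ∩ Set.Icc a b).Finite := by
  set D := {t | ¬ ∀ᶠ s in 𝓝 t, ‖f s - f t‖ ≤ ε} with hD
  have key : ∀ {u w : ℝ} {y : X}, (∀ s ∈ Set.Ioo u w, dist (f s) y < ε / 2) →
      ∀ t ∈ Set.Ioo u w, t ∉ D := by
    intro u w y h t ht
    rw [hD, Set.mem_ofPred_eq, not_not]
    filter_upwards [Ioo_mem_nhds ht.1 ht.2] with s hs
    rw [← dist_eq_norm]
    linarith [dist_triangle_right (f s) (f t) y, h s hs, h t ht]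
  refine cousin_induction (Q := fun u v => (D ∩ Set.Icc u v).Finite) hab ?_ ?_ ?_
  · intro u v w _ _ _ _ h1 h2
    refine (h1.union h2).subset ?_
    rw [← Set.inter_union_distrib_left]
    exact Set.inter_subset_inter_right _ Set.Icc_subset_Icc_union_Icc
  · intro τ _
    obtain ⟨y, hy⟩ := (hf τ).2
    obtain ⟨w, hw, H⟩ := mem_nhdsGT_iff_exists_Ioo_subset.1
      (Metric.tendsto_nhds.1 hy (ε / 2) (half_pos hε))
    filter_upwards [Ioo_mem_nhdsGT hw] with v hv
    refine (Set.finite_singleton τ).subset fun t ht => ?_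
    by_contra hne
    exact key (fun s hs => H hs) t
      ⟨lt_of_le_of_ne ht.2.1 (Ne.symm hne), ht.2.2.trans_lt hv.2⟩ ht.1
  · intro τ _
    obtain ⟨y, hy⟩ := (hf τ).1
    obtain ⟨w, hw, H⟩ := mem_nhdsLT_iff_exists_Ioo_subset.1
      (Metric.tendsto_nhds.1 hy (ε / 2) (half_pos hε))
    filter_upwards [Ioo_mem_nhdsLT hw] with v hv
    refine (Set.finite_singleton τ).subset fun t ht => ?_
    by_contra hne
    exact key (fun s hs => H hs) t
      ⟨hv.1.trans_le ht.2.1, lt_of_le_of_ne ht.2.2 hne⟩ ht.1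

/-- A regulated function has countably many discontinuities. -/
theorem IsRegulated.countable_not_continuousAt {f : ℝ → X} (hf : IsRegulated f) :
    {t | ¬ ContinuousAt f t}.Countable := by
  have : {t | ¬ ContinuousAt f t} ⊆ ⋃ (k : ℕ) (N : ℕ),
      ({t | ¬ ∀ᶠ s in 𝓝 t, ‖f s - f t‖ ≤ 1 / ((k : ℝ) + 1)} ∩
        Set.Icc (-((N : ℝ) + 1)) (N + 1)) := by
    intro t ht
    have hex : ∃ k : ℕ, ¬ ∀ᶠ s in 𝓝 t, ‖f s - f t‖ ≤ 1 / ((k : ℝ) + 1) := by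
      by_contra! h
      refine ht (Metric.tendsto_nhds.2 fun ε hε => ?_)
      obtain ⟨k, hk⟩ := exists_nat_one_div_lt hε
      filter_upwards [h k] with s hs
      rw [dist_eq_norm]
      exact hs.trans_lt hk
    obtain ⟨k, hk⟩ := hex
    obtain ⟨N, hN⟩ := exists_nat_ge |t|
    have := abs_le.1 hN
    exact Set.mem_iUnion₂.2 ⟨k, N, hk, by constructor <;> linarith⟩
  refine Set.Countable.mono this (Set.countable_iUnion fun k => Set.countable_iUnion fun N => ?_)
  have hN : (0 : ℝ) < N + 1 := by positivity
  exact (hf.finite_setOf_oscillation (by positivity) (by linarith)).countable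

theorem exists_monotone_jumps {D : Set ℝ} (hD : D.Countable) :
    ∃ N : ℝ → ℝ, Monotone N ∧ ∀ t ∈ D, ∃ c > 0, ∀ s ≠ t, c ≤ |N s - N t| := by
  obtain ⟨e, he⟩ := Set.countable_iff_exists_subset_range.1 hD
  -- Two steps of height 2⁻ⁿ at `e n`, one left-continuous and one right-continuous, so that the
  -- value at `e n` is separated from both sides.
  set φ : ℕ → ℝ → ℝ := fun n t =>
    (1 / 2) ^ n * ((if e n < t then 1 else 0) + (if e n ≤ t then 1 else 0)) with hφ
  have hmono : ∀ n, Monotone (φ n) := by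
    intro n s t hst
    refine mul_le_mul_of_nonneg_left (add_le_add ?_ ?_) (by positivity)
    · split_ifs with h1 h2
      · exact le_rfl
      · exact absurd (h1.trans_le hst) h2
      · exact zero_le_one
      · exact le_rfl
    · split_ifs with h1 h2
      · exact le_rfl
      · exact absurd (h1.trans hst) h2
      · exact zero_le_one
      · exact le_rfl
  have hsum : ∀ t, Summable fun n => φ n t := by
    intro t
    refine Summable.of_nonneg_of_le (fun n => ?_) (fun n => ?_)
      (summable_geometric_two.mul_right (2 : ℝ))
    · refine mul_nonneg (by positivity) ?_
      split_ifs <;> norm_num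
    · refine mul_le_mul_of_nonneg_left ?_ (by positivity)
      split_ifs <;> norm_num
  have hdiff : ∀ n s t, s ≤ t → φ n t - φ n s ≤ ∑' n, φ n t - ∑' n, φ n s := by
    intro n s t hst
    rw [← (hsum t).tsum_sub (hsum s)]
    exact ((hsum t).sub (hsum s)).le_tsum n fun m _ => sub_nonneg.2 (hmono m hst)
  refine ⟨fun t => ∑' n, φ n t, fun s t hst => (hsum s).tsum_le_tsum (fun n => hmono n hst) (hsum t),
    fun t ht => ?_⟩
  obtain ⟨n, rfl⟩ := he ht
  refine ⟨(1 / 2) ^ n, by positivity, fun s hs => ?_⟩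
  rcases lt_or_gt_of_ne hs with h | h
  · rw [abs_sub_comm]
    refine le_trans (le_of_eq ?_) ((hdiff n s (e n) h.le).trans (le_abs_self _))
    simp [hφ, h.not_ge, h.le.not_gt]
  · refine le_trans (le_of_eq ?_) ((hdiff n (e n) s h.le).trans (le_abs_self _))
    simp only [hφ, h, h.le, lt_irrefl, le_refl, if_true, if_false]
    ring

theorem norm_sub_le_variationOnFromTo {A : ℝ → X} (hA : LocallyBoundedVariationOn A Set.univ)
    {s t : ℝ} (hst : s ≤ t) :
    ‖A t - A s‖ ≤ variationOnFromTo A Set.univ 0 t - variationOnFromTo A Set.univ 0 s := by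
  rw [variationOnFromTo.sub_right hA (Set.mem_univ _) (Set.mem_univ _) (Set.mem_univ _),
    variationOnFromTo.eq_of_le _ _ hst, ← dist_eq_norm, dist_edist]
  exact ENNReal.toReal_mono (hA s t (Set.mem_univ _) (Set.mem_univ _))
    (eVariationOn.edist_le A ⟨Set.mem_univ _, hst, le_rfl⟩ ⟨Set.mem_univ _, le_rfl, hst⟩)

/-- A monotone function that dominates `A` and jumps at the discontinuities of `f`. -/
theorem exists_majorant {Y : Type*} [NormedAddCommGroup Y] {A : ℝ → X} {f : ℝ → Y}
    (hA : LocallyBoundedVariationOn A Set.univ) (hf : IsRegulated f) :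
    ∃ M : ℝ → ℝ, Monotone M ∧ IsDominated M A ∧ ∀ a b, RegOn M a b f := by
  obtain ⟨N, hN, hJ⟩ := exists_monotone_jumps hf.countable_not_continuousAt
  set V : ℝ → ℝ := variationOnFromTo A Set.univ 0 with hV
  have hVm : Monotone V := monotoneOn_univ.1 (variationOnFromTo.monotoneOn hA (Set.mem_univ 0))
  have hMm : Monotone (fun t => V t + N t) := hVm.add hN
  have hreg : ∀ (l : Filter ℝ) (t : ℝ), l ≤ 𝓝[≠] t → (∃ y, Tendsto f l (𝓝 y)) →
      RegAt (fun t => V t + N t) l t f := by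
    refine fun l t hl hy => ⟨hy, ?_⟩
    by_cases hc : ContinuousAt f t
    · exact Or.inr (hc.tendsto.mono_left (hl.trans nhdsWithin_le_nhds))
    · obtain ⟨c, hc0, hc⟩ := hJ t hc
      refine Or.inl ⟨c, hc0, hl ?_⟩
      filter_upwards [self_mem_nhdsWithin] with s hs
      refine (hc s hs).trans ?_
      rcases le_total s t with h | h
      · rw [abs_of_nonpos (sub_nonpos.2 (hN h)), abs_of_nonpos (sub_nonpos.2 (hMm h))]
        linarith [hVm h]
      · rw [abs_of_nonneg (sub_nonneg.2 (hN h)), abs_of_nonneg (sub_nonneg.2 (hMm h))]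
        linarith [hVm h]
  refine ⟨fun t => V t + N t, hMm, fun s t => ?_, fun a b => ⟨fun t _ => ?_, fun t _ => ?_⟩⟩
  · wlog hst : s ≤ t generalizing s t
    · rw [norm_sub_rev, abs_sub_comm]
      exact this t s (le_of_not_ge hst)
    refine (norm_sub_le_variationOnFromTo hA hst).trans (le_trans ?_ (le_abs_self _))
    linarith [hN hst]
  · exact hreg _ t (nhdsWithin_mono _ fun s hs => ne_of_gt hs) (hf t).2
  · exact hreg _ t (nhdsWithin_mono _ fun s hs => ne_of_lt hs) (hf t).1

end Majorant

/-! ### Equivalence of the integral equation with the local condition. -/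

variable {E : Type*} [NormedAddCommGroup E] [NormedSpace ℝ E]
variable {M : ℝ → ℝ} {A : ℝ → E →L[ℝ] E} {f x x' F g : ℝ → E} {s τ : ℝ}

theorem tendsto_residual_of_hasKSIntegral (h : ∀ t, HasKSIntegral A g s t (F t - F s)) (τ : ℝ) :
    Tendsto (fun v => F v - F τ - (A v - A τ) (g τ)) (𝓝[<] τ) (𝓝 0) ∧
    Tendsto (fun v => F v - F τ - (A v - A τ) (g τ)) (𝓝[>] τ) (𝓝 0) := by
  have h1 : ∀ b, ∀ t ∈ Set.Icc s b, HasKSIntegralOn A g s t (F t - F s) :=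
    fun b t ht => (h t).1 ht.1
  have h2 : ∀ b, ∀ t ∈ Set.Icc (-s) b, HasKSIntegralOn (fun t => A (-t)) (fun t => g (-t)) (-s) t
      (F (-t) - F (- -s)) := by
    intro b t ht
    have := ((h (-t)).2 (by linarith [ht.1])).reflect
    simpa using this
  constructor
  · rcases lt_or_ge s τ with hs | hs
    · exact tendsto_residual_left (h1 τ) ⟨hs, le_rfl⟩
    · have := (tendsto_residual_right (F := fun t => F (-t)) (h2 (-τ + 1)) (τ := -τ)
        ⟨by linarith, by linarith⟩).comp tendsto_neg_nhdsLT
      simpa [Function.comp_def] using this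
  · rcases le_or_gt s τ with hs | hs
    · exact tendsto_residual_right (h1 (τ + 1)) ⟨hs, by linarith⟩
    · have := (tendsto_residual_left (F := fun t => F (-t)) (h2 (-τ)) (τ := -τ)
        ⟨by linarith, le_rfl⟩).comp tendsto_neg_nhdsGT
      simpa [Function.comp_def] using this

/-- A function that satisfies the integral equation from one base point solves it in the local
sense. -/
theorem isPrimitive_of_hasKSIntegral [CompleteSpace E] (hM : Monotone M) (hA : IsDominated M A)
    (hf : ∀ a b, RegOn M a b f)
    (h : ∀ t, HasKSIntegral A x s t ((x t - f t) - (x s - f s))) :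
    IsPrimitive M A x (fun t => x t - f t) Set.univ := by
  set F : ℝ → E := fun t => x t - f t with hF
  have hx : ∀ a b, RegOn M a b x := by
    intro a b
    have hFr : RegOn M a b F :=
      ⟨fun τ hτ => ((hA.regOn hM a b).1 τ hτ).of_residual
        (tendsto_residual_of_hasKSIntegral (F := F) h τ).2,
      fun τ hτ => ((hA.regOn hM a b).2 τ hτ).of_residual
        (tendsto_residual_of_hasKSIntegral (F := F) h τ).1⟩
    simpa [hF] using hFr.add (hf a b)
  refine IsPrimitive.univ fun a b => ?_
  -- The interval is enlarged to contain the base point `s`, so that `G` can be compared with the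
  -- integrals starting at `s`.
  set p := min a s - 1
  set q := max b s + 1
  have hp : p < a ∧ p < s := ⟨by linarith [min_le_left a s], by linarith [min_le_right a s]⟩
  have hq : b < q ∧ s < q := ⟨by linarith [le_max_left b s], by linarith [le_max_right b s]⟩
  obtain ⟨G, hG⟩ := exists_isPrimitive hM hA (hx p q) (hp.2.trans hq.2)
  have hGF : ∀ t ∈ Set.Icc p q, G t + (F s - G s) = F t := by
    intro t ht
    have h1 : HasKSIntegral A x s t (G t - G s) := by
      refine ⟨fun _ => (hG.mono_set (Set.Icc_subset_Icc hp.2.le ht.2)).hasKSIntegralOn hM,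
        fun _ => ?_⟩
      rw [neg_sub]
      exact (hG.mono_set (Set.Icc_subset_Icc ht.1 hq.2.le)).hasKSIntegralOn hM
    have h2 := h1.unique (h t)
    rw [show G t = G t - G s + G s by abel, h2]
    simp only [hF]
    abel
  exact ((hG.add_const (F s - G s)).congr (fun _ _ => rfl) hGF).mono_set
    (Set.Icc_subset_Icc hp.1.le hq.1.le)

theorem isSolution_iff_isPrimitive [CompleteSpace E] (hM : Monotone M) (hA : IsDominated M A)
    (hf : ∀ a b, RegOn M a b f) :
    IsSolution A f x ↔ IsPrimitive M A x (fun t => x t - f t) Set.univ := by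
  have e : ∀ s t, x t - x s - (f t - f s) = (x t - f t) - (x s - f s) := fun s t => by abel
  constructor
  · intro h
    refine isPrimitive_of_hasKSIntegral hM hA hf (s := 0) fun t => ?_
    rw [← e]
    exact h 0 t
  · intro h s t
    rw [e]
    exact h.hasKSIntegral hM s t

theorem eq_of_isPrimitive [CompleteSpace E] (hM : Monotone M) (hA : IsDominated M A)
    (hH : JumpsInvertible A) (h : IsPrimitive M A x (fun t => x t - f t) Set.univ)
    (h' : IsPrimitive M A x' (fun t => x' t - f t) Set.univ) (hs : x s = x' s) : x = x' := by
  funext t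
  exact eqOn_of_eq hM hA hH (h.mono_set (Set.subset_univ (Set.Icc (min s t) (max s t))))
    (h'.mono_set (Set.subset_univ _)) (c := s) ⟨min_le_left _ _, le_max_left _ _⟩ hs
    ⟨min_le_right _ _, le_max_right _ _⟩

theorem IsSolution.translate {ω : ℝ} (hA : ∀ s t, A (t + ω) - A (s + ω) = A t - A s)
    (hf : Function.Periodic f ω) (h : IsSolution A f x) : IsSolution A f (fun t => x (t + ω)) := by
  intro s t
  have := (h (s + ω) (t + ω)).translate hA
  rwa [hf, hf] at this

theorem HasKSIntegral.eq_zero_of_self {X : E} (h : HasKSIntegral A g s s X) : X = 0 := by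
  refine norm_le_zero_iff.1 (le_of_forall_pos_le_add fun ε hε => ?_)
  obtain ⟨δ, -, H⟩ := hasKSIntegralOn_iff.1 (h.1 le_rfl) ε hε
  have := H 0 (.refl s)
  rw [zero_sub, norm_neg] at this
  linarith

/-! ### The transition matrix, variation of constants and the dichotomy. -/

section Transition

theorem IsTransitionMatrix.apply_self {U : ℝ → ℝ → E →L[ℝ] E} (h : IsTransitionMatrix A U)
    (s : ℝ) : U s s = 1 := by
  ext v
  exact sub_eq_zero.1 (h s s v).eq_zero_of_self

theorem IsTransitionMatrix.isPrimitive [CompleteSpace E] {U : ℝ → ℝ → E →L[ℝ] E}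
    (h : IsTransitionMatrix A U) (hM : Monotone M) (hA : IsDominated M A) (s : ℝ) (v : E) :
    IsPrimitive M A (fun t => U t s v) (fun t => U t s v) Set.univ := by
  have := isPrimitive_of_hasKSIntegral (f := fun _ => 0) (x := fun t => U t s v) (s := s) hM hA
    (fun _ _ => .const 0) fun t => by
      have h1 := h t s v
      simpa [h.apply_self] using h1
  simpa using this

theorem IsTransitionMatrix.unique [CompleteSpace E] {U V : ℝ → ℝ → E →L[ℝ] E}
    (h : IsTransitionMatrix A U) (h' : IsTransitionMatrix A V) (hM : Monotone M)
    (hA : IsDominated M A) (hH : JumpsInvertible A) : V = U := by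
  funext t s
  ext v
  exact congrFun (eq_of_isPrimitive (f := fun _ => 0) (s := s) (x := fun t => V t s v)
    (x' := fun t => U t s v) hM hA hH (by simpa using h'.isPrimitive hM hA s v)
    (by simpa using h.isPrimitive hM hA s v) (by simp [h.apply_self, h'.apply_self])) t

/-- Both sides, applied to a vector, are homogeneous solutions in `t` that agree at `t = r`. -/
theorem IsTransitionMatrix.mul [CompleteSpace E] {U : ℝ → ℝ → E →L[ℝ] E}
    (h : IsTransitionMatrix A U) (hM : Monotone M)
    (hA : IsDominated M A) (hH : JumpsInvertible A) (t r s : ℝ) : U t r * U r s = U t s := by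
  ext v
  exact congrFun (eq_of_isPrimitive (f := fun _ => 0) (s := r) (x := fun t => U t r (U r s v))
    (x' := fun t => U t s v) hM hA hH (by simpa using h.isPrimitive hM hA r (U r s v))
    (by simpa using h.isPrimitive hM hA s v) (by simp [h.apply_self])) t

theorem IsTransitionMatrix.inverse_eq [CompleteSpace E] {U : ℝ → ℝ → E →L[ℝ] E}
    (h : IsTransitionMatrix A U) (hM : Monotone M)
    (hA : IsDominated M A) (hH : JumpsInvertible A) (t s : ℝ) :
    Ring.inverse (U t s) = U s t :=
  Ring.inverse_unit ⟨U t s, U s t, by rw [h.mul hM hA hH, h.apply_self],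
    by rw [h.mul hM hA hH, h.apply_self]⟩

variable [FiniteDimensional ℝ E]

theorem exists_isTransitionMatrix (hM : Monotone M) (hA : IsDominated M A)
    (hH : JumpsInvertible A) : ∃ U, IsTransitionMatrix A U := by
  have : CompleteSpace E := FiniteDimensional.complete ℝ E
  choose u hu hP using fun (s : ℝ) (v : E) =>
    exists_solution (f := fun _ => 0) hM hA hH (fun _ _ => .const 0) s v
  simp only [sub_zero] at hP
  have hadd : ∀ s v w, u s (v + w) = fun t => u s v t + u s w t := fun s v w =>
    eq_of_isPrimitive (f := fun _ => 0) (s := s) hM hA hH (by simpa using hP s (v + w))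
      (by simpa using (hP s v).add (hP s w)) (by simp only [hu])
  have hsmul : ∀ s (r : ℝ) v, u s (r • v) = fun t => r • u s v t := fun s r v =>
    eq_of_isPrimitive (f := fun _ => 0) (s := s) hM hA hH (by simpa using hP s (r • v))
      (by simpa using (hP s v).smul r) (by simp only [hu])
  refine ⟨fun t s => LinearMap.toContinuousLinearMap
    { toFun := fun v => u s v t
      map_add' := fun v w => by rw [hadd]
      map_smul' := fun r v => by rw [hsmul]; rfl }, fun t s v => ?_⟩
  have := (hP s v).hasKSIntegral hM s t
  rwa [hu] at this

theorem isTransitionMatrix_transitionMatrix (hM : Monotone M) (hA : IsDominated M A)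
    (hH : JumpsInvertible A) : IsTransitionMatrix A (transitionMatrix A) := by
  have h := exists_isTransitionMatrix hM hA hH
  rw [transitionMatrix, dif_pos h]
  exact h.choose_spec

theorem tendsto_of_forall_tendsto_apply {l : Filter ℝ} {T : ℝ → E →L[ℝ] E} {L : E →L[ℝ] E}
    (h : ∀ v, Tendsto (fun t => T t v) l (𝓝 (L v))) : Tendsto T l (𝓝 L) := by
  obtain ⟨C, hC, H⟩ := (Module.finBasis ℝ E).exists_opNorm_le (F := E)
  refine Metric.tendsto_nhds.2 fun ε hε => ?_
  have hpos : 0 < ε / (2 * C) := by positivity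
  filter_upwards [eventually_all.2 fun i =>
    Metric.tendsto_nhds.1 (h (Module.finBasis ℝ E i)) _ hpos] with t ht
  rw [dist_eq_norm]
  refine (H (u := T t - L) hpos.le fun i => ?_).trans_lt ?_
  · have := ht i
    rw [dist_eq_norm] at this
    exact this.le
  · rw [show C * (ε / (2 * C)) = ε / 2 by field_simp]
    exact half_lt_self hε

theorem IsTransitionMatrix.eventually_norm_le_of_residual {U : ℝ → ℝ → E →L[ℝ] E} {l : Filter ℝ}
    {L : E →L[ℝ] E} (h : IsTransitionMatrix A U) (hM : Monotone M) (hA : IsDominated M A)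
    (hH : JumpsInvertible A) (hL : Tendsto A l (𝓝 L)) (hu : IsUnit (1 + (L - A τ)))
    (hres : ∀ v, Tendsto (fun t => U t τ v - U τ τ v - (A t - A τ) (U τ τ v)) l (𝓝 0)) :
    ∃ C, ∀ᶠ v in l, ‖U τ v‖ ≤ C := by
  have : CompleteSpace E := FiniteDimensional.complete ℝ E
  have hlim : Tendsto (fun t => U t τ) l (𝓝 (1 + (L - A τ))) := by
    refine tendsto_of_forall_tendsto_apply fun v => ?_
    have := ((hres v).add (tendsto_clm_apply (hL.sub_const (A τ)) v)).const_add v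
    simpa [h.apply_self] using this
  obtain ⟨W, hW⟩ := hu
  rw [← hW] at hlim
  have hinv := ((NormedRing.inverse_continuousAt W).tendsto.comp hlim).norm
  refine ⟨‖Ring.inverse (W : E →L[ℝ] E)‖ + 1, ?_⟩
  filter_upwards [hinv.eventually (gt_mem_nhds (lt_add_one _))] with t ht
  rw [← h.inverse_eq hM hA hH]
  exact ht.le

/-- U(v,τ) has invertible one-sided limits as v → τ by (H), so its inverse U(τ,v) stays bounded.
Variation of constants needs this bound to carry `o(M v - M τ)` errors through U(T,v). -/
theorem IsTransitionMatrix.eventually_norm_le {U : ℝ → ℝ → E →L[ℝ] E}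
    (h : IsTransitionMatrix A U) (hM : Monotone M) (hA : IsDominated M A)
    (hH : JumpsInvertible A) (T τ : ℝ) : ∃ C > 0, ∀ᶠ v in 𝓝 τ, ‖U T v‖ ≤ C := by
  have : CompleteSpace E := FiniteDimensional.complete ℝ E
  have hb : τ - 1 < τ ∧ τ < τ + 1 := ⟨by linarith, by linarith⟩
  have hP : ∀ v, IsPrimitive M A (fun t => U t τ v) (fun t => U t τ v)
      (Set.Icc (τ - 1) (τ + 1)) := fun v =>
    (h.isPrimitive hM hA τ v).mono_set (Set.subset_univ _)
  have hreg := hA.regOn hM (τ - 1) (τ + 1)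
  have hr := hreg.1 τ ⟨hb.1.le, hb.2⟩
  have hl := hreg.2 τ ⟨hb.1, hb.2.le⟩
  obtain ⟨L, hL⟩ := hr.1
  obtain ⟨L', hL'⟩ := hl.1
  have hu : IsUnit (1 + (L' - A τ)) := by
    rw [show (1 : E →L[ℝ] E) + (L' - A τ) = 1 - (A τ - L') by abel]
    exact (hH τ L').1 hL'
  have hres : ∀ v, Tendsto (fun t => U t τ v - U τ τ v - (A t - A τ) (U τ τ v)) (𝓝[>] τ) (𝓝 0) :=
    fun v => by
      have := (hP v).tendsto_residual_right hM (τ := τ) ⟨hb.1.le, hb.2⟩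
      exact this
  have hres' : ∀ v, Tendsto (fun t => U t τ v - U τ τ v - (A t - A τ) (U τ τ v)) (𝓝[<] τ) (𝓝 0) :=
    fun v => by
      have := (hP v).tendsto_residual_left hM (τ := τ) ⟨hb.1, hb.2.le⟩
      exact this
  obtain ⟨C, hC⟩ := h.eventually_norm_le_of_residual hM hA hH hL ((hH τ L).2 hL) hres
  obtain ⟨C', hC'⟩ := h.eventually_norm_le_of_residual hM hA hH hL' hu hres'
  obtain ⟨K, hK⟩ : ∃ K, max (max C C') ‖U τ τ‖ = K := ⟨_, rfl⟩
  have hK0 : 0 ≤ K := hK ▸ (norm_nonneg _).trans (le_max_right _ _)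
  have hev : ∀ᶠ v in 𝓝 τ, ‖U τ v‖ ≤ K := by
    rw [← nhdsWithin_eq_nhds.2 (Icc_mem_nhds hb.1 hb.2), ← hK]
    refine eventually_nhdsWithin_Icc (le_max_right _ _) (fun _ => ?_) fun _ => ?_
    · exact hC.mono fun v hv => hv.trans ((le_max_left _ _).trans (le_max_left _ _))
    · exact hC'.mono fun v hv => hv.trans ((le_max_right _ _).trans (le_max_left _ _))
  refine ⟨‖U T τ‖ * K + 1, by positivity, ?_⟩
  filter_upwards [hev] with v hv
  rw [← h.mul hM hA hH T τ v]
  refine (norm_mul_le _ _).trans ?_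
  linarith [mul_le_mul_of_nonneg_left hv (norm_nonneg (U T τ))]

/-- Variation of constants, in differential form. -/
theorem IsTransitionMatrix.isPrimitive_variation {U : ℝ → ℝ → E →L[ℝ] E}
    (h : IsTransitionMatrix A U) (hM : Monotone M) (hA : IsDominated M A)
    (hH : JumpsInvertible A) (hx : IsPrimitive M A x (fun t => x t - f t) Set.univ) (T : ℝ)
    (c : E) : IsPrimitive M (fun s => U T s) (fun s => f s - c)
      (fun s => -(U T s (x s - (f s - c)))) Set.univ := by
  have : CompleteSpace E := FiniteDimensional.complete ℝ E
  intro ε hε τ hτ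
  obtain ⟨C, hC, hCev⟩ := h.eventually_norm_le hM hA hH T τ
  have hη : 0 < ε / (2 * C) := by positivity
  have h1 := hx _ hη τ hτ
  have h2 := h.isPrimitive hM hA τ (x τ) _ hη τ hτ
  rw [nhdsWithin_univ] at h1 h2 ⊢
  filter_upwards [h1, h2, hCev] with v h1 h2 h3
  simp only [h.apply_self, one_apply_eq_self] at h2
  have hmul : U T τ (x τ) = U T v (U v τ (x τ)) := by
    rw [← h.mul hM hA hH T v τ]; rfl
  -- Both `x - f` and U(·,τ)x(τ) have the leading increment (A(v) - A(τ))x(τ); it cancels, leaving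
  -- U(T,v) applied to a difference of two small residuals.
  have hid : -(U T v (x v - (f v - c))) - -(U T τ (x τ - (f τ - c))) -
      (U T v - U T τ) (f τ - c) =
      -(U T v ((x v - f v - (x τ - f τ) - (A v - A τ) (x τ)) -
        (U v τ (x τ) - x τ - (A v - A τ) (x τ)))) := by
    simp only [map_sub, _root_.sub_apply, ← hmul]
    abel
  rw [hid, norm_neg]
  have hn := ((U T v).le_opNorm _).trans (mul_le_mul h3 ((norm_sub_le _ _).trans
    (add_le_add h1 h2)) (norm_nonneg _) hC.le)
  refine hn.trans (le_of_eq ?_)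
  field_simp
  ring

/-- Under an exponential dichotomy, a homogeneous equation with periodic increments has no
nontrivial periodic solution. -/
theorem isUnit_one_sub_transitionMatrix {ω : ℝ} (hω : 0 < ω) (hM : Monotone M)
    (hA : IsDominated M A) (hH : JumpsInvertible A)
    (hAω : ∀ s t, A (t + ω) - A (s + ω) = A t - A s) (hD : HasExpDichotomy A) :
    IsUnit (1 - transitionMatrix A ω 0) := by
  have : CompleteSpace E := FiniteDimensional.complete ℝ E
  have hU := isTransitionMatrix_transitionMatrix hM hA hH
  set U := transitionMatrix A with hUdef
  have hinj : Function.Injective (1 - U ω 0 : E →L[ℝ] E) := by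
    rw [injective_iff_map_eq_zero]
    intro v hv
    have hv : U ω 0 v = v := (sub_eq_zero.1 hv).symm
    have hP : IsPrimitive M A (fun t => U t 0 v) (fun t => U t 0 v - (0 : ℝ → E) t) Set.univ := by
      simpa using hU.isPrimitive hM hA 0 v
    have h0 : ∀ a b, RegOn M a b (0 : ℝ → E) := fun _ _ => .const 0
    have hper : Function.Periodic (fun t => U t 0 v) ω := by
      have h1 := ((isSolution_iff_isPrimitive hM hA h0).2 hP).translate hAω fun _ => rfl
      exact congrFun (eq_of_isPrimitive (s := 0) hM hA hH
        ((isSolution_iff_isPrimitive hM hA h0).1 h1) hP (by simp [hv, hU.apply_self]))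
    have hint : ∀ k : ℤ, Ring.inverse (U (k * ω) 0) v = v := by
      intro k
      have h1 : U (k * ω) 0 v = v := by
        have := (hper.int_mul k) 0
        simpa [hU.apply_self] using this
      rw [hU.inverse_eq hM hA hH]
      nth_rewrite 1 [← h1]
      show (U 0 (k * ω) * U (k * ω) 0) v = v
      rw [hU.mul hM hA hH, hU.apply_self]
      rfl
    obtain ⟨K, α, P, hK, hα, -, hs, hu⟩ := hD
    rw [← hUdef] at hs hu
    have hlim : Tendsto (fun k : ℕ => K * Real.exp (-α * (k * ω)) * ‖v‖) atTop (𝓝 0) := by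
      have h1 : Tendsto (fun k : ℕ => -α * ((k : ℝ) * ω)) atTop atBot :=
        (tendsto_natCast_atTop_atTop.atTop_mul_const hω).const_mul_atTop_of_neg (neg_lt_zero.2 hα)
      simpa using ((Real.tendsto_exp_atBot.comp h1).const_mul K).mul_const ‖v‖
    have key : ∀ Q : E →L[ℝ] E, (∀ k : ℕ, ∃ j : ℤ,
        ‖U 0 0 * Q * Ring.inverse (U (j * ω) 0)‖ ≤ K * Real.exp (-α * (k * ω))) → Q v = 0 := by
      intro Q hQ
      refine norm_le_zero_iff.1 (ge_of_tendsto' hlim fun k => ?_)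
      obtain ⟨j, hj⟩ := hQ k
      have h1 := ContinuousLinearMap.le_of_opNorm_le _ hj v
      rw [hU.apply_self, one_mul] at h1
      change ‖Q (Ring.inverse (U (j * ω) 0) v)‖ ≤ _ at h1
      rwa [hint] at h1
    -- The stable estimate compares time 0 with the earlier time -kω, the unstable one with the
    -- later time kω; hence the opposite signs of the integer index.
    have hPv : P v = 0 := key P fun k => ⟨-k, by
      have := hs 0 (-(k * ω)) (by have : (0 : ℝ) ≤ k * ω := by positivity
                                  linarith)
      simpa using this⟩
    have hQv : (1 - P) v = 0 := key (1 - P) fun k => ⟨k, by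
      have := hu 0 (k * ω) (by positivity)
      simpa using this⟩
    rw [_root_.sub_apply, hPv, sub_zero] at hQv
    exact hQv
  rw [ContinuousLinearMap.isUnit_iff_bijective]
  exact ⟨hinj, (LinearMap.injective_iff_surjective
    (f := ((1 - U ω 0 : E →L[ℝ] E) : E →ₗ[ℝ] E))).1 hinj⟩

end Transition

end GLDE

/-! ### The periodic solution. -/

theorem mainTheorem2 (n : ℕ)
    (A : ℝ → EuclideanSpace ℝ (Fin n) →L[ℝ] EuclideanSpace ℝ (Fin n))
    (C : EuclideanSpace ℝ (Fin n) →L[ℝ] EuclideanSpace ℝ (Fin n))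
    (f : ℝ → EuclideanSpace ℝ (Fin n)) (ω : ℝ) (hω : 0 < ω)
    (hA : LocallyBoundedVariationOn A Set.univ)
    (hAC : ∀ t : ℝ, A (t + ω) - A t = C)
    (hf : GLDE.IsRegulated f) (hfω : Function.Periodic f ω)
    (hH : GLDE.ConditionH A) (hD : GLDE.HasExpDichotomy A) :
    -- the transition matrix exists and is unique
    (GLDE.IsTransitionMatrix A (GLDE.transitionMatrix A) ∧
      ∀ V, GLDE.IsTransitionMatrix A V → V = GLDE.transitionMatrix A) ∧
    -- there is exactly one periodic solution
    (∃! x : ℝ → EuclideanSpace ℝ (Fin n),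
      GLDE.IsSolution A f x ∧ Function.Periodic x ω) ∧
    -- it is regulated, and it is the unique solution with the stated initial value
    IsUnit (1 - GLDE.transitionMatrix A ω 0) ∧
    ∃ J : EuclideanSpace ℝ (Fin n),
      GLDE.HasKSIntegral (fun s => GLDE.transitionMatrix A ω s) (fun s => f s - f 0) 0 ω J ∧
      ∃ x : ℝ → EuclideanSpace ℝ (Fin n),
        GLDE.IsRegulated x ∧ GLDE.IsSolution A f x ∧ Function.Periodic x ω ∧
        x 0 = -(Ring.inverse (1 - GLDE.transitionMatrix A ω 0) J) ∧
        ∀ y : ℝ → EuclideanSpace ℝ (Fin n), GLDE.IsSolution A f y →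
          y 0 = -(Ring.inverse (1 - GLDE.transitionMatrix A ω 0) J) → y = x := by
  obtain ⟨M, hM, hAM, hfM⟩ := GLDE.exists_majorant hA hf
  have hJ := hH.jumpsInvertible
  have hU := GLDE.isTransitionMatrix_transitionMatrix hM hAM hJ
  have hAω : ∀ s t, A (t + ω) - A (s + ω) = A t - A s := fun s t => by
    rw [sub_eq_sub_iff_sub_eq_sub, hAC, hAC]
  have hunit := GLDE.isUnit_one_sub_transitionMatrix hω hM hAM hJ hAω hD
  have hsol := fun x => GLDE.isSolution_iff_isPrimitive (x := x) hM hAM hfM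
  set U := GLDE.transitionMatrix A with hUdef
  have hvar : ∀ x, GLDE.IsSolution A f x →
      GLDE.HasKSIntegral (fun s => U ω s) (fun s => f s - f 0) 0 ω (U ω 0 (x 0) - x ω) := by
    intro x hx
    have := (hU.isPrimitive_variation hM hAM hJ ((hsol x).1 hx) ω (f 0)).hasKSIntegral hM 0 ω
    have hfω0 : f ω = f 0 := by simpa using hfω 0
    simp only [hU.apply_self, hfω0, sub_self, sub_zero, one_apply_eq_self] at this
    rwa [neg_sub_neg] at this
  have huniq : ∀ x y, GLDE.IsSolution A f x → GLDE.IsSolution A f y → x 0 = y 0 → x = y :=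
    fun x y hx hy h => GLDE.eq_of_isPrimitive hM hAM hJ ((hsol x).1 hx) ((hsol y).1 hy) h
  -- Any solution may be used to produce `J`: by uniqueness of the integral, the expression in
  -- `hvar` is the same for all of them.
  obtain ⟨z, -, hz⟩ := GLDE.exists_solution hM hAM hJ hfM 0 0
  have hJz := hvar z ((hsol z).2 hz)
  set J := U ω 0 (z 0) - z ω with hJdef
  have hinit : ∀ x, GLDE.IsSolution A f x →
      (x ω = x 0 ↔ x 0 = -(Ring.inverse (1 - U ω 0) J)) := by
    intro x hx
    have hJx : U ω 0 (x 0) - x ω = J := (hvar x hx).unique hJz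
    have h1 : ∀ v, Ring.inverse (1 - U ω 0) ((1 - U ω 0) v) = v := fun v =>
      congrArg (fun T : EuclideanSpace ℝ (Fin n) →L[ℝ] EuclideanSpace ℝ (Fin n) => T v)
        (Ring.inverse_mul_cancel _ hunit)
    have h2 : ∀ v, (1 - U ω 0) (Ring.inverse (1 - U ω 0) v) = v := fun v =>
      congrArg (fun T : EuclideanSpace ℝ (Fin n) →L[ℝ] EuclideanSpace ℝ (Fin n) => T v)
        (Ring.mul_inverse_cancel _ hunit)
    have h3 : (1 - U ω 0) (x 0) = x 0 - U ω 0 (x 0) := rfl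
    constructor
    · intro h
      have h4 : (1 - U ω 0) (x 0) = -J := by rw [h3, ← hJx, h]; abel
      rw [← map_neg, ← h4, h1]
    · intro h
      have h4 : (1 - U ω 0) (x 0) = -J := by rw [h, map_neg, h2]
      rw [h3, ← hJx, neg_sub] at h4
      exact (sub_left_injective h4).symm
  -- The translate by ω is again a solution, since the increments of `A` and `f` are periodic;
  -- agreement at 0 forces it to equal `x`.
  have hper : ∀ x, GLDE.IsSolution A f x → x ω = x 0 → Function.Periodic x ω := by
    intro x hx h
    exact congrFun (huniq _ x (hx.translate hAω hfω) hx (by simpa using h))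
  obtain ⟨x, hx0, hxP⟩ := GLDE.exists_solution hM hAM hJ hfM 0 (-(Ring.inverse (1 - U ω 0) J))
  have hx : GLDE.IsSolution A f x := (hsol x).2 hxP
  have hxper := hper x hx ((hinit x hx).2 hx0)
  have hxreg : GLDE.IsRegulated x := by
    intro t
    have h1 := ((hxP.mono_set (Set.subset_univ (Set.Icc (t - 1) (t + 1)))).regOn hM hAM).add
      (hfM (t - 1) (t + 1))
    simp only [sub_add_cancel] at h1
    exact ⟨(h1.2 t ⟨by linarith, by linarith⟩).1, (h1.1 t ⟨by linarith, by linarith⟩).1⟩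
  refine ⟨⟨hU, fun V hV => hU.unique hV hM hAM hJ⟩, ⟨x, ⟨hx, hxper⟩, fun y hy => ?_⟩, hunit,
    J, hJz, x, hxreg, hx, hxper, hx0, fun y hy hy0 => huniq y x hy hx (hy0.trans hx0.symm)⟩
  refine huniq y x hy.1 hx (((hinit y hy.1).1 ?_).trans hx0.symm)
  simpa using hy.2 0
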